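/- Write $\Delta=\frac14(\partial_x^2+\partial_y^2)$ on $\mathbb C$. Let $Q:\mathbb C\to\mathbb R\cup\{+\infty\}$ be lower semicontinuous, put $\Sigma_0=\{Q<\infty\}$, and assume that $\operatorname{Int}\Sigma_0$ is dense in $\Sigma_0$, that $Q$ is real-analytic on $\operatorname{Int}\Sigma_0$, and that $\liminf_{\zeta\to\infty}Q(\zeta)/\log|\zeta|^2>1$. Let $\sigma$ be an equilibrium measure, i.e. a minimizer of $$I_Q[\mu]=\iint_{\mathbb C^2}\Big(\log\frac1{|\zeta-\eta|}+\frac{Q(\zeta)+Q(\eta)}2\Big)\,d\mu(\zeta)\,d\mu(\eta)$$ among all Borel probability measures $\mu$ on $\mathbb C$, and let $S=\operatorname{supp}\sigma$ (the droplet). Assume that $S\subset\operatorname{Int}\Sigma_0$ and that $\Delta Q>0$ in a neighbourhood of $S$. For each $n$ let $\mathcal F_n=\{\zeta_{n1},\dots,\zeta_{nn}\}$ be an $n$-Fekete set, i.e. a minimizer over $\mathbb C^n$ of $$H_n(\zeta_1,\dots,\zeta_n)=\sum_{j\ne k}\log\frac1{|\zeta_j-\zeta_k|}+n\sum_{j=1}^nQ(\zeta_j).$$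 Let $\mathcal F=\{\mathcal F_n\}$, and define the asymptotic separation constant $$\Delta(\mathcal F)=\liminf_{n\to\infty}\,\min_{j}\,\sqrt{n\,\Delta Q(\zeta_{nj})}\;\min_{k\ne j}|\zeta_{nk}-\zeta_{nj}|,$$ where $j$ runs over the indices with $\zeta_{nj}\in\operatorname{Int}\Sigma_0$ (so that $\Delta Q(\zeta_{nj})$ is defined). Then $\Delta(\mathcal F)\ge 1/\sqrt e$. In other words, there are real numbers $\varepsilon_n\to0$ such that, for all large $n$ and all $j$ with $\zeta_{nj}\in\operatorname{Int}\Sigma_0$, one has $\Delta Q(\zeta_{nj})>0$ and $$|\zeta_{nk}-\zeta_{nj}|\ge\frac{1+\varepsilon_n}{\sqrt{e\,n\,\Delta Q(\zeta_{nj})}}\qquad(k\ne j).$$ If moreover $Q(\zeta)\ge\liminf_{\eta\to\zeta,\ \eta\in\operatorname{Int}\Sigma_0}Q(\eta)$ for every $\zeta\in\Sigma_0\setminus\operatorname{Int}\Sigma_0$ (for instance if $Q$ is finite everywhere), then for all large $n$ every point of $\mathcal F_n$ lies in $S\subset\operatorname{Int}\Sigma_0$, so that the estimates above hold for all $j=1,\dots,n$.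 -/

import Mathlib

open MeasureTheory Filter Topology
open scoped ENNReal Laplacian

noncomputable section

namespace Fekete

/-- The set where the extended-real-valued external potential is finite. -/
def finiteSet (Q : ℂ → EReal) : Set ℂ := {z | Q z < ⊤}

/-- One quarter of the standard Laplacian of the potential, `∂ ∂̄ Q`.
It is meaningful on the interior of `finiteSet Q`, where the potential is real-analytic. -/
def lap (Q : ℂ → EReal) (z : ℂ) : ℝ := (Δ fun w : ℂ => (Q w).toReal) z / 4

/-- Standing regularity and growth assumptions on an external potential
with values in `ℝ ∪ {+∞}`. -/
structure IsExternalPotential (Q : ℂ → EReal) : Prop where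
  ne_bot : ∀ z, Q z ≠ ⊥
  lowerSemicontinuous : LowerSemicontinuous Q
  interior_dense : finiteSet Q ⊆ closure (interior (finiteSet Q))
  analytic : AnalyticOnNhd ℝ (fun z : ℂ => (Q z).toReal) (interior (finiteSet Q))
  growth : 1 < liminf (fun z : ℂ => Q z / ((Real.log (‖z‖ ^ 2) : ℝ) : EReal)) (cocompact ℂ)

/-- The logarithmic kernel `log (1 / |z - w|)`, equal to `+∞` on the diagonal. -/
def logKernel (z w : ℂ) : EReal := -ENNReal.log ‖z - w‖ₑ

/-- The integral of an extended-real-valued function: the integral of the positive part minus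
the integral of the negative part. It is only used for functions bounded from below. -/
def eintegral {α : Type*} [MeasurableSpace α] (μ : Measure α) (f : α → EReal) : EReal :=
  ((∫⁻ x, (f x).toENNReal ∂μ : ℝ≥0∞) : EReal) - ((∫⁻ x, (-f x).toENNReal ∂μ : ℝ≥0∞) : EReal)

/-- The weighted logarithmic energy `∬ log (1 / |z - w|) dμ(z) dμ(w) + ∫ Q dμ` of a probability
measure. As usual the two terms are written under one integral sign: the combined kernel is bounded
from below for an external potential, so that the energy makes sense in `(-∞, +∞]` also for measures
of unbounded support, where the separate terms may be `-∞` and `+∞`. -/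
def weightedEnergy (Q : ℂ → EReal) (μ : Measure ℂ) : EReal :=
  eintegral (μ.prod μ) fun p : ℂ × ℂ => logKernel p.1 p.2 + (Q p.1 + Q p.2) / 2

/-- `σ` is an equilibrium measure: it minimizes the weighted logarithmic energy among all Borel
probability measures on the plane. The droplet is `σ.support`. -/
structure IsEquilibriumMeasure (Q : ℂ → EReal) (σ : Measure ℂ) : Prop where
  isProbabilityMeasure : IsProbabilityMeasure σ
  minimal : ∀ ν : Measure ℂ, IsProbabilityMeasure ν → weightedEnergy Q σ ≤ weightedEnergy Q ν

/-- The energy `∑_{j ≠ k} log (1 / |ζ_j - ζ_k|) + n ∑_j Q(ζ_j)` of an `n`-point configuration. -/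
def energy (Q : ℂ → EReal) {n : ℕ} (ζ : Fin n → ℂ) : EReal :=
  (∑ j, ∑ k ∈ Finset.univ.filter (fun k => k ≠ j), logKernel (ζ j) (ζ k)) + (n : EReal) * ∑ j, Q (ζ j)

/-- An `n`-Fekete set: a configuration of `n` points of the plane that minimizes the energy. -/
def IsFeketeSet (Q : ℂ → EReal) {n : ℕ} (ζ : Fin n → ℂ) : Prop :=
  ∀ η : Fin n → ℂ, energy Q ζ ≤ energy Q η

/-- The distance from the `j`-th point to its closest neighbour (`∞` if there is only one point). -/
def nearestDist {n : ℕ} (ζ : Fin n → ℂ) (j : Fin n) : ℝ≥0∞ :=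
  ⨅ (k : Fin n) (_ : k ≠ j), edist (ζ k) (ζ j)

/-- The asymptotic separation constant
`liminf_n min_j √(n · lap Q (ζ_nj)) · d_n(ζ_nj)` of a family of configurations; the minimum is over
the points where `lap Q` is defined, i.e. those in the interior of `finiteSet Q`. -/
def separationConstant (Q : ℂ → EReal) (F : (n : ℕ) → Fin n → ℂ) : ℝ≥0∞ :=
  liminf (fun n : ℕ => ⨅ (j : Fin n) (_ : F n j ∈ interior (finiteSet Q)),
    ENNReal.ofReal (√((n : ℝ) * lap Q (F n j))) * nearestDist (F n) j) atTop

/-- The values of the potential at the non-interior points of `finiteSet Q` are not smaller than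
the lower limits of the values at nearby interior points (by lower semicontinuity, they are then
equal to these lower limits). This holds in particular if the potential is finite everywhere. -/
def NoDownwardJump (Q : ℂ → EReal) : Prop :=
  ∀ z ∈ finiteSet Q, z ∉ interior (finiteSet Q) → liminf Q (𝓝[interior (finiteSet Q)] z) ≤ Q z

end Fekete

end

/-!
Let `V(z) = ∫ log |z - w| dσ(w)` be the logarithmic potential of the equilibrium measure and `S` its
support.

*Euler–Lagrange conditions.* Testing the minimality of `σ` against uniform distributions on small
circles gives a constant `γ` with `γ + 2 V ≤ Q` on the interior of `{Q < ∞}`: no exceptional set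
occurs, since `-V` is superharmonic and `Q` is continuous there. As `V` is upper semicontinuous,
equality holds at all points of `S`. Hence `S` is compact, by the growth of `Q`, and `V` is
continuous, by the continuity principle (`IsEquilibriumMeasure.exists_isFrostman`).

*Localization.* Let `ζ j` be a Fekete point with `γ + 2 V ≤ Q` at `ζ j`, and let `p` be the monic
polynomial of degree `n - 1` that vanishes at the other points. By the Fekete property `ζ j`
maximizes `|p|² exp (-n Q)`, and by the maximum principle it also maximizes `|p|² exp (-2 n V)`
over the plane. If `ζ j ∉ S`, then this function is locally constant near `ζ j`, and the set where
it is maximal has points off any neighbourhood `U` of `S` on which `Q` is strictly subharmonic,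
because `Q - γ - 2 V` would otherwise have an interior maximum on it
(`IsFrostman.exists_isMax_notMem`). If this happened for infinitely many `n`, a compactness argument
would provide two exponents `n ≠ m` and a disk on which both `|p_n|² exp (-2 n V)` and
`|p_m|² exp (-2 m V)` are constant. Then `p_n ^ m` is a constant multiple of `p_m ^ n`, which is
impossible since the degrees `m (n - 1)` and `n (m - 1)` differ. So for large `n` these Fekete points lie in `S` (`IsFrostman.eventually_mem_support`).

*Separation.* Jensen's inequality for `p` on the circle of radius `r` about `ζ j` bounds
`2 log (r / |ζ k - ζ j|)` by `n` times the difference between the circular mean of `Q` and `Q (ζ j)`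
(`IsFeketeSet.log_le_circleMean`). This difference is `r² ΔQ(ζ j) + o(r²)`, uniformly on `S`
(`circleMeasure_expansion`). For `r = 1 / √(n ΔQ(ζ j))` the bound is `1 + o(1)`, which gives
`|ζ k - ζ j| ≥ r e^{-1/2} (1 + o(1))`.
-/

namespace Fekete

/-! ### Circle measures -/

/-- The uniform probability measure on the circle with centre `a` and radius `r`. -/
noncomputable def circleMeasure (a : ℂ) (r : ℝ) : Measure ℂ :=
  ENNReal.ofReal (2 * Real.pi)⁻¹ •
    (volume.restrict (Set.Ioc 0 (2 * Real.pi))).map (circleMap a r)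

theorem measurable_circleMap (a : ℂ) (r : ℝ) : Measurable (circleMap a r) :=
  (continuous_circleMap a r).measurable

theorem isProbabilityMeasure_circleMeasure (a : ℂ) (r : ℝ) :
    IsProbabilityMeasure (circleMeasure a r) := by
  constructor
  rw [circleMeasure, Measure.smul_apply, Measure.map_apply (measurable_circleMap a r) .univ]
  simp only [Set.preimage_univ, Measure.restrict_apply_univ, Real.volume_Ioc, sub_zero, smul_eq_mul]
  rw [← ENNReal.ofReal_mul (by positivity), inv_mul_cancel₀ (by positivity), ENNReal.ofReal_one]

theorem integral_circleMeasure {f : ℂ → ℝ} (hf : Measurable f) (a : ℂ) (r : ℝ) :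
    ∫ z, f z ∂circleMeasure a r = Real.circleAverage f a r := by
  rw [circleMeasure, integral_smul_measure, integral_map (measurable_circleMap a r).aemeasurable
    hf.aestronglyMeasurable, Real.circleAverage_def,
    intervalIntegral.integral_of_le (by positivity), ENNReal.toReal_ofReal (by positivity)]

theorem ae_circleMeasure {a : ℂ} {r : ℝ} {p : ℂ → Prop}
    (h : ∀ᵐ θ ∂(volume : Measure ℝ), p (circleMap a r θ)) (hp : MeasurableSet {z | p z}) :
    ∀ᵐ z ∂circleMeasure a r, p z := by
  refine Measure.ae_smul_measure ?_ _
  rw [ae_map_iff (measurable_circleMap a r).aemeasurable hp]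
  exact ae_restrict_of_ae h

theorem ae_circleMeasure_norm (a : ℂ) {r : ℝ} (hr : 0 < r) :
    ∀ᵐ z ∂circleMeasure a r, ‖z - a‖ = r := by
  refine ae_circleMeasure (ae_of_all _ fun θ => ?_) ?_
  · simp [circleMap, hr.le]
  · exact (isClosed_eq (by fun_prop) continuous_const).measurableSet

theorem ae_circleMeasure_ne (a : ℂ) {r : ℝ} (hr : 0 < r) (w : ℂ) :
    ∀ᵐ z ∂circleMeasure a r, z ≠ w := by
  refine ae_circleMeasure ?_ (MeasurableSet.singleton w).compl
  have h : (circleMap a r ⁻¹' {w}).Countable :=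
    (Set.countable_singleton w).preimage_circleMap a hr.ne'
  filter_upwards [h.ae_notMem volume] with θ hθ using hθ

theorem integrable_log_circleMeasure (a w : ℂ) (r : ℝ) :
    Integrable (fun z => Real.log ‖z - w‖) (circleMeasure a r) := by
  refine Integrable.smul_measure ?_ ENNReal.ofReal_ne_top
  have hm : Measurable fun z : ℂ => Real.log ‖z - w‖ := by fun_prop
  rw [integrable_map_measure hm.aestronglyMeasurable (measurable_circleMap a r).aemeasurable]
  have h := circleIntegrable_log_norm_sub_const (a := w) (c := a) r
  rw [CircleIntegrable, intervalIntegrable_iff_integrableOn_Ioc_of_le (by positivity)] at h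
  exact h

theorem integral_log_circleMeasure (a w : ℂ) {r : ℝ} (hr : 0 < r) :
    ∫ z, Real.log ‖z - w‖ ∂circleMeasure a r = Real.log (max r ‖a - w‖) := by
  rw [integral_circleMeasure (by fun_prop),
    circleAverage_log_norm_sub_const_eq_log_radius_add_posLog hr.ne',
    show Real.posLog (r⁻¹ * ‖a - w‖) = max 0 (Real.log (r⁻¹ * ‖a - w‖)) from rfl]
  rcases le_total ‖a - w‖ r with h | h
  · rw [max_eq_left h, max_eq_left, add_zero]
    apply Real.log_nonpos (by positivity)
    rw [inv_mul_le_iff₀ hr]; simpa using h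
  · rw [max_eq_right h, max_eq_right, ← Real.log_mul hr.ne']
    · rw [← mul_assoc, mul_inv_cancel₀ hr.ne', one_mul]
    · have : 0 < ‖a - w‖ := hr.trans_le h
      positivity
    · apply Real.log_nonneg
      rw [le_inv_mul_iff₀ hr]; simpa using h

/-- A measurable function that is bounded on a circle is integrable for the circle measure. -/
theorem integrable_circleMeasure {f : ℂ → ℝ} (hf : Measurable f) {a : ℂ} {r C : ℝ} (hr : 0 < r)
    (hC : ∀ z, ‖z - a‖ = r → |f z| ≤ C) : Integrable f (circleMeasure a r) := by
  have := isProbabilityMeasure_circleMeasure a r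
  refine Integrable.of_bound hf.aestronglyMeasurable C ?_
  filter_upwards [ae_circleMeasure_norm a hr] with z hz using hC z hz

theorem integrable_circleMeasure_of_continuous {f : ℂ → ℝ} (hf : Continuous f) {a : ℂ} {r : ℝ}
    (hr : 0 < r) : Integrable f (circleMeasure a r) := by
  obtain ⟨C, hC⟩ := (isCompact_sphere a r).exists_bound_of_continuousOn hf.continuousOn
  exact integrable_circleMeasure hf.measurable hr fun z hz => hC z (by simpa using hz)

/-- The first and second moments of the uniform distribution on a circle. -/
theorem integral_quadratic_circleMeasure (a : ℂ) (r : ℝ) (c₁ c₂ c₃ c₄ c₅ : ℝ) :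
    ∫ z, (c₁ * (z - a).re + c₂ * (z - a).im + (c₃ * (z - a).re ^ 2 + c₄ * (z - a).im ^ 2 +
      c₅ * ((z - a).re * (z - a).im))) ∂circleMeasure a r = r ^ 2 / 2 * (c₃ + c₄) := by
  rw [integral_circleMeasure (by fun_prop), Real.circleAverage_def]
  have h : ∀ θ : ℝ, (c₁ * (circleMap a r θ - a).re + c₂ * (circleMap a r θ - a).im +
      (c₃ * (circleMap a r θ - a).re ^ 2 + c₄ * (circleMap a r θ - a).im ^ 2 +
      c₅ * ((circleMap a r θ - a).re * (circleMap a r θ - a).im))) =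
      c₁ * r * Real.cos θ + c₂ * r * Real.sin θ + (c₃ * r ^ 2 * Real.cos θ ^ 2 +
      c₄ * r ^ 2 * Real.sin θ ^ 2 + c₅ * r ^ 2 * (Real.sin θ * Real.cos θ)) := by
    intro θ
    simp [circleMap, Complex.exp_ofReal_mul_I_re, Complex.exp_ofReal_mul_I_im]
    ring
  simp_rw [h]
  have ii : ∀ g : ℝ → ℝ, Continuous g → IntervalIntegrable g volume 0 (2 * Real.pi) :=
    fun g hg => hg.intervalIntegrable _ _
  rw [intervalIntegral.integral_add (ii _ (by fun_prop)) (ii _ (by fun_prop)),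
    intervalIntegral.integral_add (ii _ (by fun_prop)) (ii _ (by fun_prop)),
    intervalIntegral.integral_add (ii _ (by fun_prop)) (ii _ (by fun_prop)),
    intervalIntegral.integral_add (ii _ (by fun_prop)) (ii _ (by fun_prop))]
  simp only [intervalIntegral.integral_const_mul, integral_cos, integral_sin, integral_cos_sq,
    integral_sin_sq, integral_sin_mul_cos₁]
  simp
  field_simp

/-- The mean of a `C²` function over a small circle is its value at the centre plus a quarter of
the Laplacian times the squared radius, up to an error that is uniformly small on compact sets. -/
theorem circleMeasure_expansion {f : ℂ → ℝ} (hfm : Measurable f) {W K : Set ℂ} (hW : IsOpen W)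
    (hf : ContDiffOn ℝ 2 f W) (hK : IsCompact K) (hKW : K ⊆ W) {ε : ℝ} (hε : 0 < ε) :
    ∃ r₀ > 0, ∀ z ∈ K, ∀ r, 0 < r → r < r₀ → Metric.closedBall z r ⊆ W ∧
      Integrable f (circleMeasure z r) ∧
      |∫ w, f w ∂circleMeasure z r - f z - r ^ 2 * (Δ f z / 4)| ≤ ε * r ^ 2 := by
  obtain ⟨δ, hδ, hδW⟩ := hK.exists_cthickening_subset_open hW hKW
  have hKδ : IsCompact (Metric.cthickening δ K) := hK.cthickening
  have hd1 : ContDiffOn ℝ 1 (fderiv ℝ f) W := hf.fderiv_of_isOpen hW (by norm_num)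
  have hd2 : ContinuousOn (fderiv ℝ (fderiv ℝ f)) W := hd1.continuousOn_fderiv_of_isOpen hW le_rfl
  obtain ⟨η, hη, huc⟩ := (Metric.uniformContinuousOn_iff (f := fderiv ℝ (fderiv ℝ f))).1
    (hKδ.uniformContinuousOn_of_continuous (hd2.mono hδW)) ε hε
  refine ⟨min δ η, lt_min hδ hη, fun z hz r hr hr0 => ?_⟩
  have hrδ : r < δ := hr0.trans_le (min_le_left _ _)
  have hrη : r < η := hr0.trans_le (min_le_right _ _)
  have hball : Metric.closedBall z r ⊆ Metric.cthickening δ K :=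
    (Metric.closedBall_subset_closedBall hrδ.le).trans (Metric.closedBall_subset_cthickening hz δ)
  have hballW := hball.trans hδW
  have hint : Integrable f (circleMeasure z r) := by
    obtain ⟨C, hC⟩ := (isCompact_closedBall z r).exists_bound_of_continuousOn
      (hf.continuousOn.mono hballW)
    exact integrable_circleMeasure hfm hr fun w hw => hC w (by simp [dist_eq_norm, hw])
  refine ⟨hballW, hint, ?_⟩
  have hdf : ∀ w ∈ W, HasFDerivAt f (fderiv ℝ f w) w := fun w hw =>
    ((hf.contDiffAt (hW.mem_nhds hw)).differentiableAt (by norm_num)).hasFDerivAt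
  have hddf : ∀ w ∈ W, HasFDerivAt (fderiv ℝ f) (fderiv ℝ (fderiv ℝ f) w) w := fun w hw =>
    ((hd1.contDiffAt (hW.mem_nhds hw)).differentiableAt (by norm_num)).hasFDerivAt
  set D := fderiv ℝ f z with hD
  set B := fderiv ℝ (fderiv ℝ f) z with hB
  have hzW := hKW hz
  have hsymm : ∀ x y, B x y = B y x := by
    have := (hf.contDiffAt (hW.mem_nhds hzW)).isSymmSndFDerivAt (by simp)
    exact fun x y => this x y
  have hzb : z ∈ Metric.closedBall z r := Metric.mem_closedBall_self hr.le
  -- Taylor's formula for `fderiv ℝ f`, and then for `f`, by the mean value inequality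
  have hstep1 : ∀ w ∈ Metric.closedBall z r, ‖fderiv ℝ f w - D - B (w - z)‖ ≤ ε * r := by
    intro w hw
    have := (convex_closedBall z r).norm_image_sub_le_of_norm_hasFDerivWithin_le'
      (f := fderiv ℝ f) (f' := fderiv ℝ (fderiv ℝ f)) (φ := B) (C := ε)
      (fun x hx => (hddf x (hballW hx)).hasFDerivWithinAt) (fun x hx => by
        have := huc x (hball hx) z (hball hzb) (lt_of_le_of_lt hx hrη)
        exact ((dist_eq_norm _ _).symm.trans_lt this).le) hzb hw
    refine this.trans ?_
    gcongr
    simpa [dist_eq_norm] using hw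
  have hstep2 : ∀ w ∈ Metric.closedBall z r,
      |f w - f z - (D (w - z) + (1 / 2) * B (w - z) (w - z))| ≤ ε * r ^ 2 := by
    intro w hw
    have hder : ∀ x ∈ Metric.closedBall z r, HasFDerivWithinAt
        (fun x => f x - (D (x - z) + (1 / 2) * B (x - z) (x - z)))
        (fderiv ℝ f x - D - B (x - z)) (Metric.closedBall z r) x := by
      intro x hx
      have h1 := hdf x (hballW hx)
      have h0 : HasFDerivAt (fun x : ℂ => x - z) (ContinuousLinearMap.id ℝ ℂ) x :=
        (hasFDerivAt_id x).sub_const z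
      have h2 : HasFDerivAt (fun x => D (x - z)) (D.comp (ContinuousLinearMap.id ℝ ℂ)) x :=
        D.hasFDerivAt.comp x h0
      have h3 := ((B.hasFDerivAt.comp x h0).clm_apply h0).const_mul (1 / 2 : ℝ)
      refine HasFDerivAt.hasFDerivWithinAt ?_
      refine (h1.sub (h2.add h3)).congr_fderiv ?_
      refine ContinuousLinearMap.ext fun v => ?_
      simp
      rw [hsymm v x, hsymm v z]
      ring
    have := (convex_closedBall z r).norm_image_sub_le_of_norm_hasFDerivWithin_le
      (C := ε * r) hder (fun x hx => hstep1 x hx) hzb hw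
    simp only [sub_self, map_zero, mul_zero, add_zero, sub_zero, Real.norm_eq_abs] at this
    have hwr : ‖w - z‖ ≤ r := by simpa [dist_eq_norm] using hw
    calc |f w - f z - (D (w - z) + (1 / 2) * B (w - z) (w - z))|
        = |f w - (D (w - z) + (1 / 2) * B (w - z) (w - z)) - f z| := by congr 1; ring
      _ ≤ ε * r * ‖w - z‖ := this
      _ ≤ ε * r * r := by gcongr
      _ = ε * r ^ 2 := by ring
  have hlap : Δ f z = B 1 1 + B Complex.I Complex.I := by
    rw [InnerProductSpace.laplacian_eq_iteratedFDeriv_complexPlane]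
    simp [iteratedFDeriv_two_apply, hB]
  have hquad : ∀ w, D (w - z) + (1 / 2) * B (w - z) (w - z) =
      D 1 * (w - z).re + D Complex.I * (w - z).im + ((1 / 2 * B 1 1) * (w - z).re ^ 2 +
      (1 / 2 * B Complex.I Complex.I) * (w - z).im ^ 2 +
      B 1 Complex.I * ((w - z).re * (w - z).im)) := by
    intro w
    have : w - z = (w - z).re • (1 : ℂ) + (w - z).im • Complex.I := by
      simpa only [Complex.real_smul, mul_one] using (Complex.re_add_im (w - z)).symm
    generalize w - z = v at this ⊢
    conv_lhs => rw [this]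
    simp only [map_add, map_smul, add_apply, smul_apply,
      smul_eq_mul]
    rw [hsymm Complex.I 1]
    ring
  have := isProbabilityMeasure_circleMeasure z r
  have hval : ∫ w, (D (w - z) + (1 / 2) * B (w - z) (w - z)) ∂circleMeasure z r =
      r ^ 2 * (Δ f z / 4) := by
    simp_rw [hquad]
    rw [integral_quadratic_circleMeasure, hlap]
    ring
  have hqi : Integrable (fun w => D (w - z) + (1 / 2) * B (w - z) (w - z)) (circleMeasure z r) :=
    integrable_circleMeasure_of_continuous (by fun_prop) hr
  have hfin : ∫ w, f w ∂circleMeasure z r - f z - r ^ 2 * (Δ f z / 4) =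
      ∫ w, (f w - f z - (D (w - z) + (1 / 2) * B (w - z) (w - z))) ∂circleMeasure z r := by
    have hi : Integrable (fun w => f w - f z) (circleMeasure z r) := hint.sub (integrable_const _)
    rw [integral_sub hi hqi, integral_sub hint (integrable_const _), hval]
    simp
  rw [hfin, ← Real.norm_eq_abs]
  have := norm_integral_le_of_norm_le_const (μ := circleMeasure z r) (C := ε * r ^ 2)
    (f := fun w => f w - f z - (D (w - z) + (1 / 2) * B (w - z) (w - z))) (by
      filter_upwards [ae_circleMeasure_norm z hr] with w hw
      exact hstep2 w (by simp [dist_eq_norm, hw]))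
  simpa using this

/-! ### Normalized energies -/

/-- The function `log (1 + |z|²)`, a continuous majorant of `log |z|²`. -/
noncomputable def logWeight (z : ℂ) : ℝ := Real.log (1 + ‖z‖ ^ 2)

theorem continuous_logWeight : Continuous logWeight := by
  unfold logWeight
  exact Continuous.log (by fun_prop) fun z => by positivity

theorem logWeight_nonneg (z : ℂ) : 0 ≤ logWeight z :=
  Real.log_nonneg (by nlinarith [sq_nonneg ‖z‖])

theorem log_norm_sub_le (z w : ℂ) (h : z ≠ w) :
    Real.log ‖z - w‖ ≤ (logWeight z + logWeight w) / 2 := by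
  have h0 : 0 < ‖z - w‖ := norm_pos_iff.2 (sub_ne_zero.2 h)
  have h1 : ‖z - w‖ ^ 2 ≤ (1 + ‖z‖ ^ 2) * (1 + ‖w‖ ^ 2) := by
    have h2 : ‖z - w‖ ^ 2 ≤ (‖z‖ + ‖w‖) ^ 2 := by gcongr; exact norm_sub_le _ _
    nlinarith [sq_nonneg (‖z‖ * ‖w‖ - 1)]
  have h3 := Real.log_le_log (by positivity) h1
  rw [Real.log_mul (by positivity) (by positivity), Real.log_pow] at h3
  unfold logWeight
  push_cast at h3
  linarith

/-- The nonnegative kernel `log (1 / |z - w|) + (log (1 + |z|²) + log (1 + |w|²)) / 2`. -/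
noncomputable def posKernel (z w : ℂ) : ℝ≥0∞ :=
  (logKernel z w + (((logWeight z + logWeight w) / 2 : ℝ) : EReal)).toENNReal

theorem logKernel_self (z : ℂ) : logKernel z z = ⊤ := by simp [logKernel]

theorem logKernel_of_ne {z w : ℂ} (h : z ≠ w) :
    logKernel z w = ((-Real.log ‖z - w‖ : ℝ) : EReal) := by
  have h0 : 0 < ‖z - w‖ := norm_pos_iff.2 (sub_ne_zero.2 h)
  rw [logKernel, ← ofReal_norm, ENNReal.log_ofReal_of_pos h0, EReal.coe_neg]

theorem logKernel_ne_bot (z w : ℂ) : logKernel z w ≠ ⊥ := by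
  rcases eq_or_ne z w with rfl | h
  · simp [logKernel_self]
  · rw [logKernel_of_ne h]; exact EReal.coe_ne_bot _

theorem posKernel_self (z : ℂ) : posKernel z z = ⊤ := by
  simp [posKernel, logKernel_self]

theorem posKernel_of_ne {z w : ℂ} (h : z ≠ w) :
    posKernel z w = ENNReal.ofReal ((logWeight z + logWeight w) / 2 - Real.log ‖z - w‖) := by
  rw [posKernel, logKernel_of_ne h, ← EReal.coe_add, EReal.real_coe_toENNReal]
  congr 1; ring

theorem posKernel_comm (z w : ℂ) : posKernel z w = posKernel w z := by
  rcases eq_or_ne z w with rfl | h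
  · rfl
  · rw [posKernel_of_ne h, posKernel_of_ne h.symm, norm_sub_rev, add_comm]

theorem continuous_ereal_add_coe {X : Type*} [TopologicalSpace X] {f : X → EReal} {g : X → ℝ}
    (hf : Continuous f) (hg : Continuous g) : Continuous fun x => f x + ((g x : ℝ) : EReal) := by
  rw [continuous_iff_continuousAt]
  intro x
  have h := EReal.continuousAt_add (p := (f x, (g x : EReal)))
    (Or.inr (EReal.coe_ne_bot _)) (Or.inr (EReal.coe_ne_top _))
  exact ContinuousAt.comp (f := fun x => (f x, (g x : EReal))) h
    (hf.prodMk (continuous_coe_real_ereal.comp hg)).continuousAt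

theorem continuous_posKernel : Continuous fun p : ℂ × ℂ => posKernel p.1 p.2 := by
  unfold posKernel
  refine Continuous.ereal_toENNReal (continuous_ereal_add_coe ?_ ?_)
  · unfold logKernel
    exact continuous_neg.comp (ENNReal.continuous_log.comp (by fun_prop))
  · have := continuous_logWeight
    fun_prop

theorem measurable_posKernel : Measurable fun p : ℂ × ℂ => posKernel p.1 p.2 :=
  continuous_posKernel.measurable

theorem measurable_posKernel_right (z : ℂ) : Measurable fun w => posKernel z w :=
  measurable_posKernel.comp (g := fun p : ℂ × ℂ => posKernel p.1 p.2) (f := fun w => (z, w))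
    measurable_prodMk_left

/-- The potential normalized by subtracting `log (1 + |z|²)` and adding a constant. -/
noncomputable def posPotential (Q : ℂ → EReal) (C : ℝ) (z : ℂ) : ℝ≥0∞ :=
  (Q z + ((C - logWeight z : ℝ) : EReal)).toENNReal

/-- The growth assumption, quantified: `Q` exceeds a multiple `c > 1` of `log (1 + |z|²)`, up to an
additive constant. -/
theorem IsExternalPotential.exists_lower_bound {Q : ℂ → EReal} (hQ : IsExternalPotential Q) :
    ∃ c > 1, ∃ C : ℝ, ∀ z, ((c * logWeight z - C : ℝ) : EReal) ≤ Q z := by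
  obtain ⟨c, hc1, hc⟩ := EReal.lt_iff_exists_real_btwn.1 hQ.growth
  have hc1 : 1 < c := by exact_mod_cast hc1
  have h1 := eventually_lt_of_lt_liminf hc
  obtain ⟨R, hR⟩ := Metric.closedBall_compl_subset_of_mem_cocompact h1 0
  obtain ⟨R', hR'R, hR'2⟩ : ∃ R', R ≤ R' ∧ 2 ≤ R' := ⟨max R 2, le_max_left _ _, le_max_right _ _⟩
  have hne : (Metric.closedBall (0 : ℂ) R').Nonempty := ⟨0, by simp; linarith⟩
  obtain ⟨z₀, -, hz₀⟩ := LowerSemicontinuousOn.exists_isMinOn hne (isCompact_closedBall _ _)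
    (hQ.lowerSemicontinuous.lowerSemicontinuousOn _)
  obtain ⟨m, hm⟩ : ∃ m : ℝ, (m : EReal) ≤ Q z₀ := by
    obtain ⟨m, -, hm⟩ := EReal.lt_iff_exists_real_btwn.1 (bot_lt_iff_ne_bot.2 (hQ.ne_bot z₀))
    exact ⟨m, hm.le⟩
  refine ⟨c, hc1, max (c * Real.log 2) (c * Real.log (1 + R' ^ 2) - m), fun z => ?_⟩
  by_cases hz : z ∈ Metric.closedBall (0 : ℂ) R'
  · refine le_trans ?_ (hm.trans (hz₀ hz))
    norm_cast
    have hz' : ‖z‖ ≤ R' := by simpa using hz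
    have : logWeight z ≤ Real.log (1 + R' ^ 2) :=
      Real.log_le_log (by positivity) (by gcongr)
    have := le_max_right (c * Real.log 2) (c * Real.log (1 + R' ^ 2) - m)
    nlinarith
  · have hz' : R' < ‖z‖ := by simpa using hz
    have hz2 : 2 < ‖z‖ := hR'2.trans_lt hz'
    have hzR : z ∈ (Metric.closedBall (0 : ℂ) R)ᶜ := by
      simpa using hR'R.trans_lt hz'
    have hlog : 0 < Real.log (‖z‖ ^ 2) := Real.log_pos (by nlinarith)
    have h2 : (c : EReal) < Q z / ((Real.log (‖z‖ ^ 2) : ℝ) : EReal) := hR hzR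
    rw [EReal.lt_div_iff (by exact_mod_cast hlog) (EReal.coe_ne_top _)] at h2
    refine le_trans ?_ h2.le
    norm_cast
    have : logWeight z ≤ Real.log 2 + Real.log (‖z‖ ^ 2) := by
      rw [← Real.log_mul (by norm_num) (by positivity)]
      exact Real.log_le_log (by positivity) (by nlinarith)
    have := le_max_left (c * Real.log 2) (c * Real.log (1 + R' ^ 2) - m)
    nlinarith

/-- For a function bounded from below, the extended integral can be computed by adding a constant
that makes the function nonnegative. -/
theorem eintegral_eq {α : Type*} [MeasurableSpace α] {μ : Measure α} [IsProbabilityMeasure μ]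
    {f : α → EReal} {C : ℝ} (hC : 0 ≤ C) (hf : ∀ x, ((-C : ℝ) : EReal) ≤ f x)
    (hm : Measurable fun x => (f x + (C : EReal)).toENNReal) :
    eintegral μ f = ((∫⁻ x, (f x + (C : EReal)).toENNReal ∂μ : ℝ≥0∞) : EReal) - (C : EReal) := by
  have hpt : ∀ x, (f x).toENNReal + ENNReal.ofReal C =
      (f x + (C : EReal)).toENNReal + (-f x).toENNReal := by
    intro x
    induction h : f x with
    | bot => exact absurd (hf x) (by rw [h]; simp)
    | top => simp
    | coe y =>
      have hy : -C ≤ y := by have := hf x; rw [h] at this; exact_mod_cast this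
      rw [← EReal.coe_add, ← EReal.coe_neg]
      simp only [EReal.real_coe_toENNReal]
      rcases le_total 0 y with h0 | h0
      · rw [ENNReal.ofReal_of_nonpos (by linarith : -y ≤ 0), add_zero,
          ENNReal.ofReal_add h0 hC]
      · rw [ENNReal.ofReal_of_nonpos h0, zero_add, ← ENNReal.ofReal_add (by linarith) (by linarith)]
        congr 1; ring
  have hneg : ∀ x, (-f x).toENNReal ≤ ENNReal.ofReal C := by
    intro x
    rw [← EReal.real_coe_toENNReal]
    apply EReal.toENNReal_le_toENNReal
    rw [EReal.neg_le]
    exact_mod_cast hf x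
  have hnegi : ∫⁻ x, (-f x).toENNReal ∂μ ≠ ⊤ := by
    refine ne_top_of_le_ne_top (b := ENNReal.ofReal C) ENNReal.ofReal_ne_top ?_
    exact (lintegral_mono hneg).trans (by simp)
  have hsum : ∫⁻ x, (f x).toENNReal ∂μ + ENNReal.ofReal C =
      ∫⁻ x, (f x + (C : EReal)).toENNReal ∂μ + ∫⁻ x, (-f x).toENNReal ∂μ := by
    rw [← lintegral_add_left hm, ← lintegral_congr hpt, lintegral_add_right _ measurable_const]
    simp
  rw [eintegral]
  generalize ∫⁻ x, (f x).toENNReal ∂μ = P at *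
  generalize ∫⁻ x, (-f x).toENNReal ∂μ = N at *
  generalize ∫⁻ x, (f x + (C : EReal)).toENNReal ∂μ = T at *
  lift N to NNReal using hnegi
  by_cases hT : T = ⊤
  · have hP : P = ⊤ := by
      by_contra hP
      rw [hT, top_add] at hsum
      exact ENNReal.add_ne_top.2 ⟨hP, ENNReal.ofReal_ne_top⟩ hsum
    rw [hT, hP]
    simp only [EReal.coe_ennreal_top]
    rw [EReal.coe_nnreal_eq_coe_real, EReal.top_sub_coe, EReal.top_sub_coe]
  · have hP : P ≠ ⊤ := by
      rintro rfl
      rw [top_add] at hsum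
      exact ENNReal.add_ne_top.2 ⟨hT, ENNReal.coe_ne_top⟩ hsum.symm
    lift T to NNReal using hT
    lift P to NNReal using hP
    have h := congrArg ENNReal.toReal hsum
    rw [ENNReal.toReal_add ENNReal.coe_ne_top ENNReal.ofReal_ne_top,
      ENNReal.toReal_add ENNReal.coe_ne_top ENNReal.coe_ne_top, ENNReal.toReal_ofReal hC] at h
    simp only [ENNReal.coe_toReal] at h
    simp only [EReal.coe_nnreal_eq_coe_real, ← EReal.coe_sub]
    congr 1
    linarith

/-- The mutual energy of two measures with respect to the nonnegative kernel. -/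
noncomputable def mutualEnergy (μ ν : Measure ℂ) : ℝ≥0∞ :=
  ∫⁻ z, ∫⁻ w, posKernel z w ∂ν ∂μ

theorem mutualEnergy_comm (μ ν : Measure ℂ) [SFinite μ] [SFinite ν] :
    mutualEnergy μ ν = mutualEnergy ν μ := by
  rw [mutualEnergy, lintegral_lintegral_swap measurable_posKernel.aemeasurable]
  simp_rw [mutualEnergy, posKernel_comm]

theorem IsExternalPotential.measurable_posPotential {Q : ℂ → EReal} (hQ : IsExternalPotential Q)
    (C : ℝ) : Measurable (posPotential Q C) := by
  have := hQ.lowerSemicontinuous.measurable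
  have := continuous_logWeight.measurable
  unfold posPotential
  exact Measurable.ereal_toENNReal (by fun_prop)

/-- The weighted energy in terms of nonnegative integrands. -/
theorem weightedEnergy_eq {Q : ℂ → EReal} (hQ : IsExternalPotential Q) {C : ℝ} (hC : 0 ≤ C)
    (hb : ∀ z, ((logWeight z - C : ℝ) : EReal) ≤ Q z) (ν : Measure ℂ) [IsProbabilityMeasure ν] :
    weightedEnergy Q ν =
      ((mutualEnergy ν ν + ∫⁻ z, posPotential Q C z ∂ν : ℝ≥0∞) : EReal) - (C : EReal) := by
  have hbm := hQ.measurable_posPotential C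
  -- the energy kernel plus `C` splits into three nonnegative terms
  have hkey : ∀ p : ℂ × ℂ, ((-C : ℝ) : EReal) ≤ logKernel p.1 p.2 + (Q p.1 + Q p.2) / 2 ∧
      (logKernel p.1 p.2 + (Q p.1 + Q p.2) / 2 + (C : EReal)).toENNReal =
      posKernel p.1 p.2 + (posPotential Q C p.1 + posPotential Q C p.2) / 2 := by
    rintro ⟨z, w⟩
    simp only
    have hz := hb z
    have hw := hb w
    have hzb := hQ.ne_bot z
    have hwb := hQ.ne_bot w
    have htop2 : (⊤ : EReal) / 2 = ⊤ := EReal.top_div_of_pos_ne_top (by norm_num) (by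
      exact_mod_cast EReal.coe_ne_top 2)
    unfold posPotential
    generalize hx : Q z = x at *
    generalize hy : Q w = y at *
    by_cases hxt : x = ⊤
    · have : (x + y) / 2 = ⊤ := by rw [hxt, EReal.top_add_of_ne_bot hwb, htop2]
      rw [this, EReal.add_top_of_ne_bot (logKernel_ne_bot _ _)]
      rw [hxt, EReal.top_add_coe, EReal.top_add_coe]
      simp [ENNReal.top_div]
    by_cases hyt : y = ⊤
    · have : (x + y) / 2 = ⊤ := by rw [hyt, EReal.add_top_of_ne_bot hzb, htop2]
      rw [this, EReal.add_top_of_ne_bot (logKernel_ne_bot _ _)]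
      rw [hyt, EReal.top_add_coe, EReal.top_add_coe]
      simp [ENNReal.top_div]
    lift x to ℝ using ⟨hxt, hzb⟩
    lift y to ℝ using ⟨hyt, hwb⟩
    have h2 : ((x : EReal) + (y : EReal)) / 2 = (((x + y) / 2 : ℝ) : EReal) := by
      rfl
    rw [h2]
    rcases eq_or_ne z w with rfl | hne
    · rw [logKernel_self, posKernel_self]
      simp
    · rw [logKernel_of_ne hne, posKernel_of_ne hne]
      have hl := log_norm_sub_le z w hne
      norm_cast at hz hw
      simp only [← EReal.coe_add, EReal.real_coe_toENNReal, EReal.coe_le_coe_iff]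
      refine ⟨by linarith, ?_⟩
      rw [← ENNReal.ofReal_add (by linarith) (by linarith),
        show (2 : ℝ≥0∞) = ENNReal.ofReal 2 by simp,
        ← ENNReal.ofReal_div_of_pos (by norm_num), ← ENNReal.ofReal_add (by linarith) (by linarith)]
      congr 1; ring
  have hfun : (fun p : ℂ × ℂ => (logKernel p.1 p.2 + (Q p.1 + Q p.2) / 2 + (C : EReal)).toENNReal) =
      fun p => posKernel p.1 p.2 + (posPotential Q C p.1 + posPotential Q C p.2) / 2 :=
    funext fun p => (hkey p).2
  rw [weightedEnergy, eintegral_eq hC (fun p => (hkey p).1)]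
  · rw [hfun, lintegral_add_left measurable_posKernel,
      lintegral_prod _ measurable_posKernel.aemeasurable]
    congr 3
    rw [lintegral_prod _ (by fun_prop)]
    have : ∀ z, ∫⁻ w, (posPotential Q C z + posPotential Q C w) / 2 ∂ν =
        (posPotential Q C z + ∫⁻ w, posPotential Q C w ∂ν) / 2 := by
      intro z
      simp_rw [div_eq_mul_inv]
      rw [lintegral_mul_const _ (by fun_prop), lintegral_add_left measurable_const]
      simp
    simp_rw [this, div_eq_mul_inv]
    rw [lintegral_mul_const _ (by fun_prop), lintegral_add_right _ measurable_const]
    simp only [lintegral_const, measure_univ, mul_one]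
    rw [← div_eq_mul_inv, ENNReal.add_div, ENNReal.add_halves]
  · rw [hfun]
    have := measurable_posKernel
    fun_prop

/-- A minimizer of the weighted energy minimizes its nonnegative version. -/
theorem IsEquilibriumMeasure.le {Q : ℂ → EReal} (hQ : IsExternalPotential Q) {C : ℝ} (hC : 0 ≤ C)
    (hb : ∀ z, ((logWeight z - C : ℝ) : EReal) ≤ Q z) {σ : Measure ℂ}
    (hσ : IsEquilibriumMeasure Q σ) (ν : Measure ℂ) [hν : IsProbabilityMeasure ν] :
    mutualEnergy σ σ + ∫⁻ z, posPotential Q C z ∂σ ≤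
      mutualEnergy ν ν + ∫⁻ z, posPotential Q C z ∂ν := by
  have := hσ.isProbabilityMeasure
  have h := hσ.minimal ν hν
  rw [weightedEnergy_eq hQ hC hb, weightedEnergy_eq hQ hC hb] at h
  have h' := add_le_add_left h (C : EReal)
  rw [EReal.sub_add_cancel, EReal.sub_add_cancel] at h'
  exact EReal.coe_ennreal_le_coe_ennreal_iff.1 h'

/-- The first variation of the energy at a minimizer, in the direction of a measure `ν` of finite
energy. -/
theorem IsEquilibriumMeasure.variation {Q : ℂ → EReal} (hQ : IsExternalPotential Q) {C : ℝ}
    (hC : 0 ≤ C) (hb : ∀ z, ((logWeight z - C : ℝ) : EReal) ≤ Q z) {σ : Measure ℂ}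
    (hσ : IsEquilibriumMeasure Q σ) (ν : Measure ℂ) [hν : IsProbabilityMeasure ν]
    (hν1 : mutualEnergy ν ν ≠ ⊤) (hν2 : ∫⁻ z, posPotential Q C z ∂ν ≠ ⊤) :
    2 * mutualEnergy σ σ + ∫⁻ z, posPotential Q C z ∂σ ≤
      2 * mutualEnergy σ ν + ∫⁻ z, posPotential Q C z ∂ν := by
  have hσP := hσ.isProbabilityMeasure
  by_cases hσν : mutualEnergy σ ν = ⊤
  · simp [hσν]
  have hfin := ne_top_of_le_ne_top (ENNReal.add_ne_top.2 ⟨hν1, hν2⟩) (hσ.le hQ hC hb ν)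
  obtain ⟨hσ1, hσ2⟩ := ENNReal.add_ne_top.1 hfin
  have hineq : ∀ s t : NNReal, s + t = 1 →
      mutualEnergy σ σ + ∫⁻ z, posPotential Q C z ∂σ ≤
      (s * (s * mutualEnergy σ σ + t * mutualEnergy σ ν) +
        t * (s * mutualEnergy σ ν + t * mutualEnergy ν ν)) +
      (s * ∫⁻ z, posPotential Q C z ∂σ + t * ∫⁻ z, posPotential Q C z ∂ν) := by
    intro s t hst
    have hP : IsProbabilityMeasure ((s : ℝ≥0∞) • σ + (t : ℝ≥0∞) • ν) := by
      constructor
      simp only [Measure.add_apply, Measure.smul_apply, measure_univ, smul_eq_mul, mul_one]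
      exact_mod_cast hst
    refine (hσ.le hQ hC hb ((s : ℝ≥0∞) • σ + (t : ℝ≥0∞) • ν)).trans (le_of_eq ?_)
    have hm : ∀ μ : Measure ℂ, [IsProbabilityMeasure μ] →
        Measurable fun z => ∫⁻ w, posKernel z w ∂μ :=
      fun μ _ => measurable_posKernel.lintegral_prod_right'
    rw [mutualEnergy_comm σ ν]
    conv_rhs => enter [1, 1]; rw [mutualEnergy_comm ν σ]
    simp only [mutualEnergy, lintegral_add_measure, lintegral_smul_measure, smul_eq_mul]
    have h1 := hm σ
    have h2 := hm ν
    rw [lintegral_add_left (by fun_prop), lintegral_add_left (by fun_prop),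
      lintegral_const_mul _ h1, lintegral_const_mul _ h1, lintegral_const_mul _ h2,
      lintegral_const_mul _ h2]
  generalize mutualEnergy σ σ = x at *
  generalize mutualEnergy σ ν = y at *
  generalize mutualEnergy ν ν = v at *
  generalize ∫⁻ z, posPotential Q C z ∂σ = p at *
  generalize ∫⁻ z, posPotential Q C z ∂ν = q at *
  lift x to NNReal using hσ1
  lift y to NNReal using hσν
  lift v to NNReal using hν1
  lift p to NNReal using hσ2
  lift q to NNReal using hν2
  norm_cast at hineq ⊢
  by_contra! hcon
  have hcon' : (2 * y + q : ℝ) < 2 * x + p := by exact_mod_cast hcon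
  -- the derivative at `0` of the energy along the segment from `σ` to `ν` is `-d < 0`
  obtain ⟨d, hd⟩ : ∃ d : ℝ, d = 2 * x + p - (2 * y + q) := ⟨_, rfl⟩
  have hd0 : 0 < d := by rw [hd]; linarith
  set t : ℝ := d / (d + (x + v) + 1) with ht
  have hden : 0 < d + (x + v : ℝ) + 1 := by positivity
  have ht0 : 0 < t := by positivity
  have ht1 : t < 1 := by
    rw [ht, div_lt_one hden]
    linarith [NNReal.coe_nonneg x, NNReal.coe_nonneg v]
  have htd : t * (d + (x + v) + 1) = d := by rw [ht]; field_simp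
  have h := hineq ⟨1 - t, by linarith⟩ ⟨t, ht0.le⟩ (NNReal.eq (sub_add_cancel 1 t))
  have h' : (x + p : ℝ) ≤ ((1 - t) * ((1 - t) * x + t * y) + t * ((1 - t) * y + t * v)) +
      ((1 - t) * p + t * q) := by exact_mod_cast h
  have h2 : t * d ≤ t * (t * (x - 2 * y + v)) := by rw [hd]; nlinarith
  have h3 := le_of_mul_le_mul_left h2 ht0
  have h4 : 0 ≤ t * (y : ℝ) := by positivity
  nlinarith

/-! ### Euler–Lagrange conditions -/

/-- The potential of a measure with respect to the nonnegative kernel. -/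
noncomputable def posPot (σ : Measure ℂ) (z : ℂ) : ℝ≥0∞ := ∫⁻ w, posKernel z w ∂σ

/-- Averaging the nonnegative kernel over a circle increases it by at most the oscillation of
`log (1 + |z|²)`: this is the superharmonicity of the logarithmic kernel. The second bound, for
points on the circle, shows that circle measures have finite energy. -/
theorem lintegral_posKernel_circleMeasure {a : ℂ} {r η : ℝ} (hr : 0 < r)
    (hη : ∀ z, ‖z - a‖ = r → logWeight z ≤ logWeight a + 2 * η) (hη0 : 0 ≤ η) (w : ℂ) :
    ∫⁻ z, posKernel z w ∂circleMeasure a r ≤ posKernel a w + ENNReal.ofReal η ∧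
    (‖w - a‖ = r → ∫⁻ z, posKernel z w ∂circleMeasure a r ≤
      ENNReal.ofReal (logWeight a + 2 * η - Real.log r)) := by
  have hP := isProbabilityMeasure_circleMeasure a r
  have hL := continuous_logWeight
  have hLi := integrable_circleMeasure_of_continuous hL hr (a := a)
  have hlog := integrable_log_circleMeasure a w r
  have h1 : ∫⁻ z, posKernel z w ∂circleMeasure a r =
      ∫⁻ z, ENNReal.ofReal ((logWeight z + logWeight w) / 2 - Real.log ‖z - w‖)
        ∂circleMeasure a r := by
    refine lintegral_congr_ae ?_
    filter_upwards [ae_circleMeasure_ne a hr w] with z hz using posKernel_of_ne hz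
  have hi' : Integrable (fun z => (logWeight z + logWeight w) / 2) (circleMeasure a r) :=
    (hLi.add (integrable_const _)).div_const 2
  have hi : Integrable (fun z => (logWeight z + logWeight w) / 2 - Real.log ‖z - w‖)
      (circleMeasure a r) := hi'.sub hlog
  have h2 : ∫ z, ((logWeight z + logWeight w) / 2 - Real.log ‖z - w‖) ∂circleMeasure a r ≤
      (logWeight a + 2 * η + logWeight w) / 2 - Real.log (max r ‖a - w‖) := by
    rw [integral_sub hi' hlog,
      integral_log_circleMeasure a w hr]
    gcongr
    calc ∫ z, (logWeight z + logWeight w) / 2 ∂circleMeasure a r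
        ≤ ∫ _, (logWeight a + 2 * η + logWeight w) / 2 ∂circleMeasure a r := by
          refine integral_mono_ae hi' (integrable_const _) ?_
          filter_upwards [ae_circleMeasure_norm a hr] with z hz
          have := hη z hz
          linarith
      _ = _ := by simp
  rw [h1, ← ofReal_integral_eq_lintegral_ofReal hi (by
    filter_upwards [ae_circleMeasure_ne a hr w] with z hz
    have := log_norm_sub_le z w hz
    simp only [Pi.zero_apply]
    linarith)]
  constructor
  · rcases eq_or_ne a w with rfl | hne
    · rw [posKernel_self, top_add]; exact le_top
    · have := log_norm_sub_le a w hne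
      rw [posKernel_of_ne hne, ← ENNReal.ofReal_add (by linarith) hη0]
      refine ENNReal.ofReal_le_ofReal (h2.trans ?_)
      have : Real.log ‖a - w‖ ≤ Real.log (max r ‖a - w‖) :=
        Real.log_le_log (norm_pos_iff.2 (sub_ne_zero.2 hne)) (le_max_right _ _)
      linarith
  · intro hw
    refine ENNReal.ofReal_le_ofReal (h2.trans ?_)
    have h3 := hη w hw
    have h4 : Real.log r ≤ Real.log (max r ‖a - w‖) := Real.log_le_log hr (le_max_left _ _)
    linarith

theorem toReal_coe_of_mem {Q : ℂ → EReal} (hQ : IsExternalPotential Q) {z : ℂ}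
    (hz : z ∈ finiteSet Q) : (((Q z).toReal : ℝ) : EReal) = Q z :=
  EReal.coe_toReal (ne_of_lt hz) (hQ.ne_bot z)

theorem posPotential_of_mem {Q : ℂ → EReal} (hQ : IsExternalPotential Q) {C : ℝ} {z : ℂ}
    (hz : z ∈ finiteSet Q) :
    posPotential Q C z = ENNReal.ofReal ((Q z).toReal + (C - logWeight z)) := by
  rw [posPotential, ← toReal_coe_of_mem hQ hz, ← EReal.coe_add, EReal.real_coe_toENNReal,
    EReal.toReal_coe]

theorem IsExternalPotential.continuousAt {Q : ℂ → EReal} (hQ : IsExternalPotential Q) {a : ℂ}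
    (ha : a ∈ interior (finiteSet Q)) : ContinuousAt (fun z => (Q z).toReal) a :=
  (hQ.analytic a ha).continuousAt

/-- Quantities attached to small circles around an interior point. -/
theorem exists_circle {Q : ℂ → EReal} (hQ : IsExternalPotential Q) (C : ℝ) {a : ℂ}
    (ha : a ∈ interior (finiteSet Q)) {η : ℝ} (hη : 0 < η) :
    ∃ r > 0, (∀ z, ‖z - a‖ = r → logWeight z ≤ logWeight a + 2 * η) ∧
      ∀ z, ‖z - a‖ = r → posPotential Q C z ≤
        ENNReal.ofReal ((Q a).toReal + (C - logWeight a) + 4 * η) := by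
  have h1 := continuous_logWeight.continuousAt (x := a) |>.eventually
    (Metric.ball_mem_nhds _ (by positivity : 0 < 2 * η))
  have h2 := (hQ.continuousAt ha).eventually
    (Metric.ball_mem_nhds _ (by positivity : 0 < 2 * η))
  have h3 := isOpen_interior.mem_nhds ha
  obtain ⟨r, hr, hball⟩ := Metric.eventually_nhds_iff_ball.1 (h1.and (h2.and h3))
  refine ⟨r / 2, by positivity, fun z hz => ?_, fun z hz => ?_⟩ <;>
  obtain ⟨hz1, hz2, hz3⟩ := hball z (by rw [Metric.mem_ball, dist_eq_norm, hz]; linarith) <;>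
  rw [Real.dist_eq, abs_lt] at hz1 hz2
  · linarith
  · rw [posPotential_of_mem hQ (interior_subset hz3)]
    exact ENNReal.ofReal_le_ofReal (by linarith)

theorem mutualEnergy_circleMeasure_ne_top {a : ℂ} {r η : ℝ} (hr : 0 < r)
    (hη : ∀ z, ‖z - a‖ = r → logWeight z ≤ logWeight a + 2 * η) (hη0 : 0 ≤ η) :
    mutualEnergy (circleMeasure a r) (circleMeasure a r) ≠ ⊤ := by
  have hP := isProbabilityMeasure_circleMeasure a r
  refine ne_top_of_le_ne_top (b := ENNReal.ofReal (logWeight a + 2 * η - Real.log r))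
    ENNReal.ofReal_ne_top ?_
  calc mutualEnergy (circleMeasure a r) (circleMeasure a r)
      ≤ ∫⁻ _, ENNReal.ofReal (logWeight a + 2 * η - Real.log r) ∂circleMeasure a r := by
        refine lintegral_mono_ae ?_
        filter_upwards [ae_circleMeasure_norm a hr] with w hw
        simp_rw [posKernel_comm w]
        exact (lintegral_posKernel_circleMeasure hr hη hη0 w).2 hw
    _ = _ := by simp

theorem lintegral_posPotential_circleMeasure_le {Q : ℂ → EReal} {C : ℝ} {a : ℂ} {r : ℝ} {B : ℝ≥0∞}
    (hr : 0 < r) (hB : ∀ z, ‖z - a‖ = r → posPotential Q C z ≤ B) :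
    ∫⁻ z, posPotential Q C z ∂circleMeasure a r ≤ B := by
  have hP := isProbabilityMeasure_circleMeasure a r
  calc ∫⁻ z, posPotential Q C z ∂circleMeasure a r ≤ ∫⁻ _, B ∂circleMeasure a r := by
        refine lintegral_mono_ae ?_
        filter_upwards [ae_circleMeasure_norm a hr] with w hw using hB w hw
    _ = _ := by simp

/-- An equilibrium measure has finite energy if the potential is finite on some open set. -/
theorem IsEquilibriumMeasure.energy_ne_top {Q : ℂ → EReal} (hQ : IsExternalPotential Q) {C : ℝ}
    (hC : 0 ≤ C) (hb : ∀ z, ((logWeight z - C : ℝ) : EReal) ≤ Q z) {σ : Measure ℂ}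
    (hσ : IsEquilibriumMeasure Q σ) {a : ℂ} (ha : a ∈ interior (finiteSet Q)) :
    2 * mutualEnergy σ σ + ∫⁻ z, posPotential Q C z ∂σ ≠ ⊤ := by
  obtain ⟨r, hr, h1, h2⟩ := exists_circle hQ C ha one_pos
  have hP := isProbabilityMeasure_circleMeasure a r
  have h := hσ.le hQ hC hb (circleMeasure a r)
  have hfin := ne_top_of_le_ne_top (ENNReal.add_ne_top.2
    ⟨mutualEnergy_circleMeasure_ne_top hr h1 zero_le_one,
    ne_top_of_le_ne_top ENNReal.ofReal_ne_top (lintegral_posPotential_circleMeasure_le hr h2)⟩) h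
  obtain ⟨h3, h4⟩ := ENNReal.add_ne_top.1 hfin
  exact ENNReal.add_ne_top.2 ⟨ENNReal.mul_ne_top (by simp) h3, h4⟩

/-- The Euler–Lagrange inequality at all interior points of the set where `Q` is finite. It is
obtained by testing minimality against the uniform distributions on small circles. -/
theorem IsEquilibriumMeasure.le_posPot {Q : ℂ → EReal} (hQ : IsExternalPotential Q) {C : ℝ}
    (hC : 0 ≤ C) (hb : ∀ z, ((logWeight z - C : ℝ) : EReal) ≤ Q z) {σ : Measure ℂ}
    (hσ : IsEquilibriumMeasure Q σ) {a : ℂ} (ha : a ∈ interior (finiteSet Q)) :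
    2 * mutualEnergy σ σ + ∫⁻ z, posPotential Q C z ∂σ ≤
      2 * posPot σ a + posPotential Q C a := by
  have hσP := hσ.isProbabilityMeasure
  have haF := interior_subset ha
  have hba : 0 ≤ (Q a).toReal + (C - logWeight a) := by
    have := hb a
    rw [← toReal_coe_of_mem hQ haF] at this
    norm_cast at this
    linarith
  refine ENNReal.le_of_forall_pos_le_add fun ε hε _ => ?_
  have hη : (0 : ℝ) < ε / 6 := by positivity
  obtain ⟨r, hr, h1, h2⟩ := exists_circle hQ C ha hη
  have hP := isProbabilityMeasure_circleMeasure a r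
  have h3 := lintegral_posPotential_circleMeasure_le hr h2
  have hv := hσ.variation hQ hC hb (circleMeasure a r)
    (mutualEnergy_circleMeasure_ne_top hr h1 hη.le)
    (ne_top_of_le_ne_top ENNReal.ofReal_ne_top h3)
  refine hv.trans ?_
  have h4 : mutualEnergy σ (circleMeasure a r) ≤ posPot σ a + ENNReal.ofReal (ε / 6) := by
    calc mutualEnergy σ (circleMeasure a r)
        ≤ ∫⁻ w, (posKernel a w + ENNReal.ofReal (ε / 6)) ∂σ := by
          refine lintegral_mono fun w => ?_
          simp_rw [posKernel_comm w]
          exact (lintegral_posKernel_circleMeasure hr h1 hη.le w).1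
      _ = _ := by
          rw [lintegral_add_right _ measurable_const]; simp [posPot]
  calc 2 * mutualEnergy σ (circleMeasure a r) + ∫⁻ z, posPotential Q C z ∂circleMeasure a r
      ≤ 2 * (posPot σ a + ENNReal.ofReal (ε / 6)) +
        ENNReal.ofReal ((Q a).toReal + (C - logWeight a) + 4 * (ε / 6)) := by gcongr
    _ = 2 * posPot σ a + posPotential Q C a + ε := by
      rw [posPotential_of_mem hQ haF, ENNReal.ofReal_add hba (by positivity), mul_add,
        show (2 : ℝ≥0∞) * ENNReal.ofReal (ε / 6) = ENNReal.ofReal (2 * (ε / 6)) by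
          rw [ENNReal.ofReal_mul (by norm_num)]; simp,
        add_add_add_comm, ← ENNReal.ofReal_add (by positivity) (by positivity),
        show (2 * (ε / 6) + 4 * (ε / 6) : ℝ) = ε by ring, ENNReal.ofReal_coe_nnreal]

theorem lowerSemicontinuous_posPot (σ : Measure ℂ) : LowerSemicontinuous (posPot σ) := by
  intro z₀ y hy
  by_contra hcon
  obtain ⟨u, hu, hle⟩ := exists_seq_forall_of_frequently (not_eventually.1 hcon)
  have h1 : posPot σ z₀ ≤ y := by
    calc posPot σ z₀ = ∫⁻ w, liminf (fun n => posKernel (u n) w) atTop ∂σ := by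
          refine lintegral_congr fun w => ?_
          have : Continuous fun z => posKernel z w :=
            continuous_posKernel.comp (g := fun p : ℂ × ℂ => posKernel p.1 p.2)
              (f := fun z => (z, w)) (by fun_prop)
          exact ((this.tendsto z₀).comp hu).liminf_eq.symm
      _ ≤ liminf (fun n => posPot σ (u n)) atTop :=
          lintegral_liminf_le fun n => measurable_posKernel_right (u n)
      _ ≤ y := by
          refine liminf_le_of_frequently_le' (Frequently.of_forall fun n => not_lt.1 (hle n))
  exact absurd hy (not_lt.2 h1)

theorem IsExternalPotential.lowerSemicontinuous_posPotential {Q : ℂ → EReal}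
    (hQ : IsExternalPotential Q) (C : ℝ) : LowerSemicontinuous (posPotential Q C) := by
  have h : LowerSemicontinuous fun z => Q z + ((C - logWeight z : ℝ) : EReal) := by
    refine hQ.lowerSemicontinuous.add' ?_ ?_
    · exact (continuous_coe_real_ereal.comp
        (continuous_const.sub continuous_logWeight)).lowerSemicontinuous
    · exact fun z => EReal.continuousAt_add (Or.inr (EReal.coe_ne_bot _))
        (Or.inr (EReal.coe_ne_top _))
  exact EReal.continuous_toENNReal.comp_lowerSemicontinuous h
    fun x y hxy => EReal.toENNReal_le_toENNReal hxy

/-- Equality holds in the Euler–Lagrange inequality on the droplet. -/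
theorem IsEquilibriumMeasure.posPot_eq {Q : ℂ → EReal} (hQ : IsExternalPotential Q) {C : ℝ}
    (hC : 0 ≤ C) (hb : ∀ z, ((logWeight z - C : ℝ) : EReal) ≤ Q z) {σ : Measure ℂ}
    (hσ : IsEquilibriumMeasure Q σ) (hS : σ.support ⊆ interior (finiteSet Q)) {a : ℂ}
    (ha : a ∈ σ.support) :
    2 * posPot σ a + posPotential Q C a =
      2 * mutualEnergy σ σ + ∫⁻ z, posPotential Q C z ∂σ := by
  have hσP := hσ.isProbabilityMeasure
  set g := 2 * mutualEnergy σ σ + ∫⁻ z, posPotential Q C z ∂σ with hg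
  have hgtop : g ≠ ⊤ := hσ.energy_ne_top hQ hC hb (hS ha)
  have hm1 : Measurable (posPot σ) := (lowerSemicontinuous_posPot σ).measurable
  have hm2 := hQ.measurable_posPotential C
  have hle : ∀ᵐ z ∂σ, g ≤ 2 * posPot σ z + posPotential Q C z := by
    filter_upwards [Measure.support_mem_ae (μ := σ)] with z hz
    exact hσ.le_posPot hQ hC hb (hS hz)
  have hint : ∫⁻ z, (2 * posPot σ z + posPotential Q C z) ∂σ = g := by
    rw [lintegral_add_right _ hm2, lintegral_const_mul _ hm1, hg]
    rfl
  have hae := ae_eq_of_ae_le_of_lintegral_le hle (by simpa using hgtop) (by fun_prop)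
    (by rw [hint]; simp)
  have hlsc : LowerSemicontinuous fun z => 2 * posPot σ z + posPotential Q C z := by
    refine LowerSemicontinuous.add ?_ (hQ.lowerSemicontinuous_posPotential C)
    simp_rw [two_mul]
    exact (lowerSemicontinuous_posPot σ).add (lowerSemicontinuous_posPot σ)
  have hopen : IsOpen {z | g < 2 * posPot σ z + posPotential Q C z} := hlsc.isOpen_preimage g
  have hnull : σ {z | g < 2 * posPot σ z + posPotential Q C z} = 0 := by
    refine measure_mono_null (fun z hz => ?_) hae
    exact fun h => (ne_of_lt hz) h
  have hsub := Measure.subset_compl_support_of_isOpen hopen hnull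
  refine le_antisymm (not_lt.1 fun h => hsub h ha) (hσ.le_posPot hQ hC hb (hS ha))

/-! ### The logarithmic potential of the equilibrium measure -/

/-- The logarithmic potential `∫ log |z - w| dσ(w)` (the negative of the usual potential). -/
noncomputable def logPot (σ : Measure ℂ) (z : ℂ) : ℝ := ∫ w, Real.log ‖z - w‖ ∂σ

/-- The Euler–Lagrange conditions `γ + 2 ∫ log |z - w| dσ(w) ≤ Q(z)` for `z` in the interior of
`finiteSet Q`, with equality on the compact support of the probability measure `σ`, whose
potential is finite and continuous everywhere. -/
structure IsFrostman (Q : ℂ → EReal) (σ : Measure ℂ) (γ : ℝ) : Prop where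
  prob : IsProbabilityMeasure σ
  compact : IsCompact σ.support
  nonempty : σ.support.Nonempty
  integrable : ∀ z, Integrable (fun w => Real.log ‖z - w‖) σ
  continuous : Continuous (logPot σ)
  le : ∀ z ∈ interior (finiteSet Q), γ + 2 * logPot σ z ≤ (Q z).toReal
  eq : ∀ z ∈ σ.support, (Q z).toReal = γ + 2 * logPot σ z

theorem ae_mem_support (σ : Measure ℂ) : ∀ᵐ w ∂σ, w ∈ σ.support := Measure.support_mem_ae

theorem integrable_logWeight {σ : Measure ℂ} [IsProbabilityMeasure σ]
    (hS : IsCompact σ.support) : Integrable logWeight σ := by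
  obtain ⟨M, hM⟩ := hS.exists_bound_of_continuousOn continuous_logWeight.continuousOn
  refine Integrable.of_bound continuous_logWeight.aestronglyMeasurable M ?_
  filter_upwards [ae_mem_support σ] with w hw using hM w hw

/-- Off a compact support the potential is finite. -/
theorem posPot_ne_top_of_notMem {σ : Measure ℂ} [IsProbabilityMeasure σ]
    (hS : IsCompact σ.support) {z : ℂ} (hz : z ∉ σ.support) : posPot σ z ≠ ⊤ := by
  obtain ⟨M, hM⟩ := hS.exists_bound_of_continuousOn continuous_logWeight.continuousOn
  obtain ⟨d, hd, hball⟩ := Metric.isOpen_iff.1 hS.isClosed.isOpen_compl z hz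
  refine ne_top_of_le_ne_top
    (b := ENNReal.ofReal ((logWeight z + M) / 2 - Real.log d)) ENNReal.ofReal_ne_top ?_
  calc posPot σ z ≤ ∫⁻ _, ENNReal.ofReal ((logWeight z + M) / 2 - Real.log d) ∂σ := by
        refine lintegral_mono_ae ?_
        filter_upwards [ae_mem_support σ] with w hw
        have hne : z ≠ w := fun h => hz (h ▸ hw)
        have hdw : d ≤ ‖z - w‖ := by
          by_contra! h
          exact hball (by rwa [Metric.mem_ball, dist_comm, dist_eq_norm]) hw
        have h1 := Real.log_le_log hd hdw
        have h2 := (le_abs_self _).trans (hM w hw)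
        rw [posKernel_of_ne hne]
        exact ENNReal.ofReal_le_ofReal (by linarith)
    _ = _ := by simp

/-- Where the normalized potential is finite, the logarithm is integrable, there is no atom, and
the two potentials agree up to the normalization. -/
theorem logPot_eq {σ : Measure ℂ} [IsProbabilityMeasure σ] (hS : IsCompact σ.support) {z : ℂ}
    (hz : posPot σ z ≠ ⊤) : (∀ᵐ w ∂σ, w ≠ z) ∧ Integrable (fun w => Real.log ‖z - w‖) σ ∧
    logPot σ z = (logWeight z + ∫ w, logWeight w ∂σ) / 2 - (posPot σ z).toReal := by
  have hLi := integrable_logWeight hS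
  have hne : ∀ᵐ w ∂σ, w ≠ z := by
    filter_upwards [ae_lt_top (measurable_posKernel_right z) hz] with w hw
    rintro rfl
    simp [posKernel_self] at hw
  have h1 : posPot σ z =
      ∫⁻ w, ENNReal.ofReal ((logWeight z + logWeight w) / 2 - Real.log ‖z - w‖) ∂σ := by
    refine lintegral_congr_ae ?_
    filter_upwards [hne] with w hw using posKernel_of_ne hw.symm
  have hnn : 0 ≤ᵐ[σ] fun w => (logWeight z + logWeight w) / 2 - Real.log ‖z - w‖ := by
    filter_upwards [hne] with w hw
    have := log_norm_sub_le z w hw.symm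
    simp only [Pi.zero_apply]
    linarith
  have hm : Measurable fun w => (logWeight z + logWeight w) / 2 - Real.log ‖z - w‖ := by
    have := continuous_logWeight.measurable
    fun_prop
  have hi : Integrable (fun w => (logWeight z + logWeight w) / 2 - Real.log ‖z - w‖) σ := by
    refine (lintegral_ofReal_ne_top_iff_integrable hm.aestronglyMeasurable hnn).1 ?_
    rwa [← h1]
  have hi' : Integrable (fun w => (logWeight z + logWeight w) / 2) σ :=
    ((integrable_const _).add hLi).div_const 2
  have hlog : Integrable (fun w => Real.log ‖z - w‖) σ := by
    refine (hi'.sub hi).congr (ae_of_all _ fun w => ?_)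
    simp
  refine ⟨hne, hlog, ?_⟩
  rw [h1, ← ofReal_integral_eq_lintegral_ofReal hi hnn,
    ENNReal.toReal_ofReal (integral_nonneg_of_ae hnn), integral_sub hi' hlog,
    integral_div, integral_add (integrable_const _) hLi]
  simp [logPot]

/-- Upper semicontinuity of the potential, by Fatou's lemma for the nonnegative kernel. -/
theorem upperSemicontinuous_logPot {σ : Measure ℂ} [IsProbabilityMeasure σ]
    (hS : IsCompact σ.support) (hfin : ∀ z, posPot σ z ≠ ⊤) (z₀ : ℂ) {ε : ℝ} (hε : 0 < ε) :
    ∀ᶠ z in 𝓝 z₀, logPot σ z < logPot σ z₀ + ε := by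
  have h1 : ∀ᶠ z in 𝓝 z₀, (posPot σ z₀).toReal - ε / 2 < (posPot σ z).toReal := by
    rcases lt_or_ge ((posPot σ z₀).toReal - ε / 2) 0 with h | h
    · exact Eventually.of_forall fun z => h.trans_le ENNReal.toReal_nonneg
    · have h2 : ENNReal.ofReal ((posPot σ z₀).toReal - ε / 2) < posPot σ z₀ := by
        rw [ENNReal.ofReal_lt_iff_lt_toReal h (hfin z₀)]; linarith
      filter_upwards [lowerSemicontinuous_posPot σ z₀ _ h2] with z hz
      exact (ENNReal.ofReal_lt_iff_lt_toReal h (hfin z)).1 hz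
  have h2 : ∀ᶠ z in 𝓝 z₀, logWeight z < logWeight z₀ + ε :=
    (continuous_logWeight.tendsto z₀).eventually (gt_mem_nhds (by linarith))
  filter_upwards [h1, h2] with z hz1 hz2
  rw [(logPot_eq hS (hfin z)).2.2, (logPot_eq hS (hfin z₀)).2.2]
  linarith

/-- The continuity principle: if the restriction of the potential to the support of the measure is
continuous at a point of the support, then so is the potential itself. -/
theorem lowerSemicontinuous_logPot_of_mem {σ : Measure ℂ} [IsProbabilityMeasure σ]
    (hS : IsCompact σ.support) (hfin : ∀ z, posPot σ z ≠ ⊤) {z₀ : ℂ} (hz₀ : z₀ ∈ σ.support)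
    (hc : ContinuousWithinAt (logPot σ) σ.support z₀) {ε : ℝ} (hε : 0 < ε) :
    ∀ᶠ z in 𝓝 z₀, logPot σ z₀ - ε < logPot σ z := by
  -- `π z` is a point of the support closest to `z`
  choose π hπS hπ using fun z => hS.exists_infDist_eq_dist ⟨z₀, hz₀⟩ z
  have hπle : ∀ z, ∀ w ∈ σ.support, dist z (π z) ≤ dist z w := fun z w hw =>
    (hπ z) ▸ Metric.infDist_le_dist_of_mem hw
  have hπ2 : ∀ z, ∀ w ∈ σ.support, ‖π z - w‖ ≤ 2 * ‖z - w‖ := by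
    intro z w hw
    have h1 := hπle z w hw
    rw [dist_eq_norm, dist_eq_norm] at h1
    calc ‖π z - w‖ = ‖(z - w) - (z - π z)‖ := by congr 1; ring
      _ ≤ ‖z - w‖ + ‖z - π z‖ := norm_sub_le _ _
      _ ≤ 2 * ‖z - w‖ := by linarith
  have hπt : Tendsto π (𝓝 z₀) (𝓝 z₀) := by
    rw [tendsto_iff_norm_sub_tendsto_zero]
    refine squeeze_zero (fun _ => norm_nonneg _) (fun z => hπ2 z z₀ hz₀) ?_
    have : Continuous fun z : ℂ => 2 * ‖z - z₀‖ := by fun_prop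
    simpa using this.tendsto z₀
  set G : ℂ → ℂ → ℝ := fun z w => max (Real.log ‖π z - w‖ - Real.log ‖z - w‖) 0 with hG
  have hbound : ∀ z, ∀ᵐ w ∂σ, ‖G z w‖ ≤ Real.log 2 := by
    intro z
    filter_upwards [ae_mem_support σ, (logPot_eq hS (hfin z)).1,
      (logPot_eq hS (hfin (π z))).1] with w hw hwz hwπ
    rw [Real.norm_eq_abs, abs_of_nonneg (le_max_right _ _)]
    refine max_le ?_ (Real.log_nonneg (by norm_num))
    have h1 : 0 < ‖z - w‖ := norm_pos_iff.2 (sub_ne_zero.2 hwz.symm)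
    have h2 : 0 < ‖π z - w‖ := norm_pos_iff.2 (sub_ne_zero.2 hwπ.symm)
    have := Real.log_le_log h2 (hπ2 z w hw)
    rw [Real.log_mul (by norm_num) h1.ne'] at this
    linarith
  have hGm : ∀ z, AEStronglyMeasurable (G z) σ := fun z => by
    have : Measurable (G z) := by simp only [hG]; fun_prop
    exact this.aestronglyMeasurable
  have hGt : Tendsto (fun z => ∫ w, G z w ∂σ) (𝓝 z₀) (𝓝 (∫ _, (0 : ℝ) ∂σ)) := by
    refine tendsto_integral_filter_of_dominated_convergence (fun _ => Real.log 2)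
      (Eventually.of_forall hGm) (Eventually.of_forall hbound) (integrable_const _) ?_
    filter_upwards [(logPot_eq hS (hfin z₀)).1] with w hw
    have hne : ‖z₀ - w‖ ≠ 0 := (norm_pos_iff.2 (sub_ne_zero.2 hw.symm)).ne'
    have h1 : Tendsto (fun z => Real.log ‖z - w‖) (𝓝 z₀) (𝓝 (Real.log ‖z₀ - w‖)) :=
      ContinuousAt.log (by fun_prop) hne
    have h2 := ((h1.comp hπt).sub h1).max (tendsto_const_nhds (x := (0 : ℝ)))
    simpa using h2
  rw [integral_zero] at hGt
  have hVπ : Tendsto (fun z => logPot σ (π z)) (𝓝 z₀) (𝓝 (logPot σ z₀)) :=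
    hc.tendsto.comp (tendsto_nhdsWithin_iff.2 ⟨hπt, Eventually.of_forall hπS⟩)
  have hlim := (hVπ.sub hGt).eventually (lt_mem_nhds (a := logPot σ z₀ - ε) (by linarith))
  filter_upwards [hlim] with z hz
  refine hz.trans_le ?_
  have i1 := (logPot_eq hS (hfin z)).2.1
  have i2 := (logPot_eq hS (hfin (π z))).2.1
  have h3 : logPot σ (π z) - logPot σ z ≤ ∫ w, G z w ∂σ := by
    rw [logPot, logPot, ← integral_sub i2 i1]
    exact integral_mono (i2.sub i1) (Integrable.of_bound (hGm z) _ (hbound z))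
      fun w => le_max_left _ _
  linarith

/-- Off the support, the potential is locally the real part of a holomorphic function. -/
theorem exists_holomorphic_re_eq {σ : Measure ℂ} [IsProbabilityMeasure σ] (hS : IsCompact σ.support)
    (hi : ∀ z, Integrable (fun w => Real.log ‖z - w‖) σ) {z₀ : ℂ} (hz₀ : z₀ ∉ σ.support) :
    ∃ r > 0, Metric.ball z₀ r ⊆ σ.supportᶜ ∧ ∃ h : ℂ → ℂ, DifferentiableOn ℂ h (Metric.ball z₀ r) ∧
      ∀ z ∈ Metric.ball z₀ r, logPot σ z = (h z).re := by
  obtain ⟨d, hd, hball⟩ := Metric.isOpen_iff.1 hS.isClosed.isOpen_compl z₀ hz₀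
  -- on the disk of half the distance to the support, `(z - w) / (z₀ - w)` stays in the right
  -- half-plane for all `w` in the support, so that its principal logarithm can be integrated
  obtain ⟨r, rfl⟩ : ∃ r, d = 2 * r := ⟨d / 2, by ring⟩
  have hr : 0 < r := by linarith
  have hsub : Metric.ball z₀ r ⊆ Metric.ball z₀ (2 * r) := Metric.ball_subset_ball (by linarith)
  have hfar : ∀ w ∈ σ.support, 2 * r ≤ ‖z₀ - w‖ := by
    intro w hw
    by_contra! h
    exact hball (by rwa [Metric.mem_ball, dist_comm, dist_eq_norm]) hw
  set f : ℂ → ℂ → ℂ := fun z w => Complex.log (1 + (z - z₀) / (z₀ - w)) with hf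
  have hsmall : ∀ z ∈ Metric.ball z₀ r, ∀ w ∈ σ.support, ‖(z - z₀) / (z₀ - w)‖ ≤ 1 / 2 := by
    intro z hz w hw
    have h1 := hfar w hw
    rw [Metric.mem_ball, dist_eq_norm] at hz
    rw [norm_div, div_le_iff₀ (by linarith)]
    linarith
  have hslit : ∀ z ∈ Metric.ball z₀ r, ∀ w ∈ σ.support,
      1 + (z - z₀) / (z₀ - w) ∈ Complex.slitPlane := fun z hz w hw =>
    Complex.mem_slitPlane_of_norm_lt_one ((hsmall z hz w hw).trans_lt (by norm_num))
  have hne0 : ∀ w ∈ σ.support, z₀ - w ≠ 0 := fun w hw =>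
    norm_pos_iff.1 (by linarith [hfar w hw])
  have hfm : ∀ z, AEStronglyMeasurable (f z) σ := fun z => by
    have : Measurable (f z) := by simp only [hf]; fun_prop
    exact this.aestronglyMeasurable
  have hfb : ∀ z ∈ Metric.ball z₀ r, ∀ᵐ w ∂σ, ‖f z w‖ ≤ 3 / 2 * (1 / 2) := by
    intro z hz
    filter_upwards [ae_mem_support σ] with w hw
    refine (Complex.norm_log_one_add_half_le_self (hsmall z hz w hw)).trans ?_
    gcongr
    exact hsmall z hz w hw
  have hfi : ∀ z ∈ Metric.ball z₀ r, Integrable (f z) σ := fun z hz =>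
    Integrable.of_bound (hfm z) _ (hfb z hz)
  have hder : ∀ z ∈ Metric.ball z₀ r, ∀ w ∈ σ.support,
      HasDerivAt (fun z => f z w) ((1 / (z₀ - w)) / (1 + (z - z₀) / (z₀ - w))) z := by
    intro z hz w hw
    have h1 : HasDerivAt (fun z : ℂ => 1 + (z - z₀) / (z₀ - w)) (1 / (z₀ - w)) z :=
      (((hasDerivAt_id z).sub_const z₀).div_const _).const_add _
    exact h1.clog (hslit z hz w hw)
  refine ⟨r, hr, hsub.trans hball, fun z => logPot σ z₀ + ∫ w, f z w ∂σ, ?_, ?_⟩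
  · intro z hz
    have hD := hasDerivAt_integral_of_dominated_loc_of_deriv_le (μ := σ) (F := f)
      (F' := fun z w => (1 / (z₀ - w)) / (1 + (z - z₀) / (z₀ - w)))
      (bound := fun _ => (1 / (2 * r)) / (1 / 2))
      (Metric.isOpen_ball.mem_nhds hz) (Eventually.of_forall hfm) (hfi z hz)
      (by
        have : Measurable fun w => (1 / (z₀ - w)) / (1 + (z - z₀) / (z₀ - w)) := by fun_prop
        exact this.aestronglyMeasurable)
      (by
        filter_upwards [ae_mem_support σ] with w hw x hx
        rw [norm_div, norm_div, norm_one]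
        have h1 := hfar w hw
        have h2 : 1 / 2 ≤ ‖1 + (x - z₀) / (z₀ - w)‖ := by
          have h3 := hsmall x hx w hw
          have h4 := norm_sub_le (1 + (x - z₀) / (z₀ - w)) ((x - z₀) / (z₀ - w))
          rw [add_sub_cancel_right, norm_one] at h4
          linarith
        gcongr)
      (integrable_const _)
      (by
        filter_upwards [ae_mem_support σ] with w hw x hx using hder x hx w hw)
    exact (hD.2.const_add _).differentiableAt.differentiableWithinAt
  · intro z hz
    have h1 : (∫ w, f z w ∂σ).re = ∫ w, (f z w).re ∂σ := by
      have := Complex.reCLM.integral_comp_comm (hfi z hz)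
      simpa using this.symm
    rw [Complex.add_re, Complex.ofReal_re, h1]
    have h2 : ∫ w, (f z w).re ∂σ = ∫ w, (Real.log ‖z - w‖ - Real.log ‖z₀ - w‖) ∂σ := by
      refine integral_congr_ae ?_
      filter_upwards [ae_mem_support σ] with w hw
      have h0 := hne0 w hw
      have h3 : 1 + (z - z₀) / (z₀ - w) = (z - w) / (z₀ - w) := by field_simp; ring
      have h4 : z - w ≠ 0 := by
        intro h
        have := Complex.slitPlane_ne_zero (hslit z hz w hw)
        rw [h3, h, zero_div] at this
        exact this rfl
      simp only [hf]
      rw [Complex.log_re, h3, norm_div,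
        Real.log_div (norm_ne_zero_iff.2 h4) (norm_ne_zero_iff.2 h0)]
    rw [h2, integral_sub (hi z) (hi z₀)]
    simp only [logPot]
    ring

/-- The constant `γ` exists. Equality on the droplet bounds the growth of `Q` there, whence
compactness; it also makes the potential continuous along the droplet, whence continuity. -/
theorem IsEquilibriumMeasure.exists_isFrostman {Q : ℂ → EReal} (hQ : IsExternalPotential Q)
    {σ : Measure ℂ} (hσ : IsEquilibriumMeasure Q σ) (hS : σ.support ⊆ interior (finiteSet Q)) :
    ∃ γ, IsFrostman Q σ γ := by
  have hσP := hσ.isProbabilityMeasure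
  obtain ⟨c, hc, C', hC'⟩ := hQ.exists_lower_bound
  obtain ⟨C, hCC', hC⟩ : ∃ C, C' ≤ C ∧ 0 ≤ C := ⟨max C' 0, le_max_left _ _, le_max_right _ _⟩
  have hcC : ∀ z, ((c * logWeight z - C : ℝ) : EReal) ≤ Q z := fun z =>
    le_trans (EReal.coe_le_coe_iff.2 (by linarith)) (hC' z)
  have hb : ∀ z, ((logWeight z - C : ℝ) : EReal) ≤ Q z := fun z =>
    le_trans (EReal.coe_le_coe_iff.2 (by nlinarith [logWeight_nonneg z])) (hcC z)
  have hne : σ.support.Nonempty := Measure.nonempty_support (IsProbabilityMeasure.ne_zero σ)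
  obtain ⟨a, ha⟩ := hne
  set g := 2 * mutualEnergy σ σ + ∫⁻ z, posPotential Q C z ∂σ with hg
  have hgtop : g ≠ ⊤ := hσ.energy_ne_top hQ hC hb (hS ha)
  have heq : ∀ z ∈ σ.support, 2 * posPot σ z + posPotential Q C z = g := fun z hz =>
    hσ.posPot_eq hQ hC hb hS hz
  have hnn : ∀ z ∈ finiteSet Q, 0 ≤ (Q z).toReal + (C - logWeight z) := by
    intro z hz
    have := hb z
    rw [← toReal_coe_of_mem hQ hz] at this
    norm_cast at this
    linarith
  have hcompact : IsCompact σ.support := by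
    refine Metric.isCompact_of_isClosed_isBounded Measure.isClosed_support ?_
    refine (Metric.isBounded_closedBall (x := (0 : ℂ))
      (r := Real.exp (g.toReal / (c - 1)))).subset fun z hz => ?_
    have hzF := interior_subset (hS hz)
    have h1 : posPotential Q C z ≤ g := by rw [← heq z hz]; exact le_add_self
    rw [posPotential_of_mem hQ hzF, ENNReal.ofReal_le_iff_le_toReal hgtop] at h1
    have h2 := hcC z
    rw [← toReal_coe_of_mem hQ hzF] at h2
    norm_cast at h2
    have h3 : logWeight z ≤ g.toReal / (c - 1) := by
      rw [le_div_iff₀ (by linarith)]; nlinarith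
    have h4 := Real.exp_le_exp.2 h3
    rw [logWeight, Real.exp_log (by positivity)] at h4
    rw [mem_closedBall_zero_iff]
    nlinarith [sq_nonneg (‖z‖ - 1)]
  have hfin : ∀ z, posPot σ z ≠ ⊤ := by
    intro z
    by_cases hz : z ∈ σ.support
    · intro h
      have := heq z hz
      rw [h, ENNReal.mul_top (by norm_num), top_add] at this
      exact hgtop this.symm
    · exact posPot_ne_top_of_notMem hcompact hz
  obtain ⟨γ, hγ⟩ : ∃ γ, γ = g.toReal - C - ∫ w, logWeight w ∂σ := ⟨_, rfl⟩
  have htoReal : ∀ z ∈ finiteSet Q, (2 * posPot σ z + posPotential Q C z).toReal =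
      2 * (posPot σ z).toReal + ((Q z).toReal + (C - logWeight z)) := by
    intro z hz
    rw [posPotential_of_mem hQ hz, ENNReal.toReal_add (ENNReal.mul_ne_top (by simp) (hfin z))
      ENNReal.ofReal_ne_top, ENNReal.toReal_ofReal (hnn z hz), ENNReal.toReal_mul]
    simp
  have heqR : ∀ z ∈ σ.support, (Q z).toReal = γ + 2 * logPot σ z := by
    intro z hz
    have h1 := htoReal z (interior_subset (hS hz))
    rw [heq z hz] at h1
    rw [(logPot_eq hcompact (hfin z)).2.2, hγ]
    linarith
  refine ⟨γ, hσP, hcompact, ⟨a, ha⟩, fun z => (logPot_eq hcompact (hfin z)).2.1, ?_, ?_, heqR⟩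
  · rw [continuous_iff_continuousAt]
    intro z₀
    have hlow : ∀ ε > 0, ∀ᶠ z in 𝓝 z₀, logPot σ z₀ - ε < logPot σ z := by
      intro ε hε
      by_cases hz₀ : z₀ ∈ σ.support
      · refine lowerSemicontinuous_logPot_of_mem hcompact hfin hz₀ ?_ hε
        have h1 : ContinuousWithinAt (fun z => ((Q z).toReal - γ) / 2) σ.support z₀ :=
          (((hQ.continuousAt (hS hz₀)).sub continuousAt_const).div_const 2).continuousWithinAt
        refine h1.congr (fun z hz => ?_) ?_
        · rw [heqR z hz]; ring
        · rw [heqR z₀ hz₀]; ring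
      · obtain ⟨r, hr, -, h, hh, hre⟩ := exists_holomorphic_re_eq hcompact
          (fun z => (logPot_eq hcompact (hfin z)).2.1) hz₀
        have hmem := Metric.isOpen_ball.mem_nhds (Metric.mem_ball_self hr (x := z₀))
        have h1 : ContinuousAt (fun z => (h z).re) z₀ :=
          Complex.continuous_re.continuousAt.comp (hh.continuousOn.continuousAt hmem)
        have h2 := h1.eventually (lt_mem_nhds (a := logPot σ z₀ - ε)
          (by
            have := hre z₀ (Metric.mem_ball_self hr)
            simp only
            linarith))
        filter_upwards [h2, hmem] with z hz hzb
        rwa [hre z hzb]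
    refine Metric.tendsto_nhds.2 fun ε hε => ?_
    filter_upwards [hlow ε hε, upperSemicontinuous_logPot hcompact hfin z₀ hε] with z h1 h2
    rw [Real.dist_eq, abs_lt]
    constructor <;> linarith
  · intro z hz
    have h1 := hσ.le_posPot hQ hC hb hz
    have hzF := interior_subset hz
    have h2 := ENNReal.toReal_mono (by
      rw [posPotential_of_mem hQ hzF]
      exact ENNReal.add_ne_top.2 ⟨ENNReal.mul_ne_top (by simp) (hfin z), ENNReal.ofReal_ne_top⟩) h1
    rw [htoReal z hzF] at h2
    rw [(logPot_eq hcompact (hfin z)).2.2, hγ]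
    linarith

/-! ### Fekete sets -/

theorem ereal_sum_ne_bot {ι : Type*} {s : Finset ι} {f : ι → EReal} (h : ∀ i ∈ s, f i ≠ ⊥) :
    ∑ i ∈ s, f i ≠ ⊥ := by
  classical
  induction s using Finset.induction_on with
  | empty => simp
  | insert a s ha ih =>
    rw [Finset.sum_insert ha]
    have h1 := h a (Finset.mem_insert_self a s)
    have h2 := ih fun i hi => h i (Finset.mem_insert_of_mem hi)
    intro h3
    rcases EReal.add_eq_bot_iff.1 h3 with h3 | h3
    exacts [h1 h3, h2 h3]

theorem ereal_sum_eq_top {ι : Type*} {s : Finset ι} {f : ι → EReal} (h : ∀ i ∈ s, f i ≠ ⊥)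
    {i : ι} (hi : i ∈ s) (hf : f i = ⊤) : ∑ i ∈ s, f i = ⊤ := by
  classical
  rw [← Finset.add_sum_erase s f hi, hf]
  exact EReal.top_add_of_ne_bot
    (ereal_sum_ne_bot fun k hk => h k (Finset.mem_of_mem_erase hk))

theorem ereal_coe_sum {ι : Type*} (s : Finset ι) (f : ι → ℝ) :
    ((∑ i ∈ s, f i : ℝ) : EReal) = ∑ i ∈ s, (f i : EReal) := by
  classical
  induction s using Finset.induction_on with
  | empty => simp
  | insert a s ha ih => rw [Finset.sum_insert ha, Finset.sum_insert ha, EReal.coe_add, ih]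

/-- The energy of a configuration of distinct points at which the potential is finite. -/
theorem energy_eq {Q : ℂ → EReal} (hQ : IsExternalPotential Q) {n : ℕ} {ζ : Fin n → ℂ}
    (hζ : Function.Injective ζ) (hfin : ∀ j, ζ j ∈ finiteSet Q) :
    energy Q ζ = ((∑ j, ∑ k ∈ Finset.univ.erase j, -Real.log ‖ζ j - ζ k‖ +
      n * ∑ j, (Q (ζ j)).toReal : ℝ) : EReal) := by
  have h1 : ∑ j, ∑ k ∈ Finset.univ.filter (fun k => k ≠ j), logKernel (ζ j) (ζ k) =
      ((∑ j, ∑ k ∈ Finset.univ.erase j, -Real.log ‖ζ j - ζ k‖ : ℝ) : EReal) := by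
    rw [ereal_coe_sum]
    refine Finset.sum_congr rfl fun j _ => ?_
    rw [ereal_coe_sum, Finset.filter_ne']
    refine Finset.sum_congr rfl fun k hk => ?_
    exact logKernel_of_ne fun h => Finset.ne_of_mem_erase hk (hζ h).symm
  have h2 : ∑ j, Q (ζ j) = ((∑ j, (Q (ζ j)).toReal : ℝ) : EReal) := by
    rw [ereal_coe_sum]
    exact Finset.sum_congr rfl fun j _ => (toReal_coe_of_mem hQ (hfin j)).symm
  rw [energy, h1, h2, EReal.coe_add, EReal.coe_mul]
  rfl

/-- A configuration of finite energy consists of distinct points where the potential is finite. -/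
theorem injective_and_mem_of_energy_ne_top {Q : ℂ → EReal} (hQ : IsExternalPotential Q) {n : ℕ}
    {ζ : Fin n → ℂ} (h : energy Q ζ ≠ ⊤) : Function.Injective ζ ∧ ∀ j, ζ j ∈ finiteSet Q := by
  have hQb : ∑ j, Q (ζ j) ≠ ⊥ := ereal_sum_ne_bot fun j _ => hQ.ne_bot _
  have hin : ∀ j : Fin n,
      ∑ k ∈ Finset.univ.filter (fun k => k ≠ j), logKernel (ζ j) (ζ k) ≠ ⊥ :=
    fun j => ereal_sum_ne_bot fun k _ => logKernel_ne_bot _ _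
  have hKb : ∑ j, ∑ k ∈ Finset.univ.filter (fun k => k ≠ j), logKernel (ζ j) (ζ k) ≠ ⊥ :=
    ereal_sum_ne_bot fun j _ => hin j
  have hnQb : (n : EReal) * ∑ j, Q (ζ j) ≠ ⊥ := by
    have hn : ((n : ℝ) : EReal) = (n : EReal) := rfl
    generalize ∑ j, Q (ζ j) = q at hQb ⊢
    induction q with
    | bot => exact absurd rfl hQb
    | coe x => rw [← hn, ← EReal.coe_mul]; exact EReal.coe_ne_bot _
    | top =>
      rcases Nat.eq_zero_or_pos n with rfl | hpos
      · simp
      · rw [← hn, EReal.coe_mul_top_of_pos (by exact_mod_cast hpos)]; simp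
  constructor
  · intro j k hjk
    by_contra hne
    refine h ?_
    rw [energy, ereal_sum_eq_top (fun j _ => hin j) (Finset.mem_univ j)
      (ereal_sum_eq_top (fun k _ => logKernel_ne_bot _ _) (i := k) ?_ ?_)]
    · exact EReal.top_add_of_ne_bot hnQb
    · simpa using fun h : k = j => hne h.symm
    · rw [hjk, logKernel_self]
  · intro j
    by_contra hj
    have hj : Q (ζ j) = ⊤ := not_lt_top_iff.1 hj
    refine h ?_
    have hpos : 0 < n := j.pos
    have hn : ((n : ℝ) : EReal) = (n : EReal) := rfl
    rw [energy, ereal_sum_eq_top (fun j _ => hQ.ne_bot _) (Finset.mem_univ j) hj, ← hn,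
      EReal.coe_mul_top_of_pos (by exact_mod_cast hpos)]
    exact EReal.add_top_of_ne_bot hKb

theorem sum_sum_erase_eq {n : ℕ} {f : Fin n → Fin n → ℝ} (hf : ∀ i k, f i k = f k i) (j : Fin n) :
    ∑ i, ∑ k ∈ Finset.univ.erase i, f i k = 2 * ∑ k ∈ Finset.univ.erase j, f j k +
      ∑ i ∈ Finset.univ.erase j, ∑ k ∈ (Finset.univ.erase i).erase j, f i k := by
  rw [← Finset.add_sum_erase _ _ (Finset.mem_univ j), two_mul, add_assoc]
  congr 1
  rw [← Finset.sum_add_distrib]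
  refine Finset.sum_congr rfl fun i hi => ?_
  rw [← Finset.add_sum_erase (Finset.univ.erase i) (f i)
    (Finset.mem_erase.2 ⟨(Finset.ne_of_mem_erase hi).symm, Finset.mem_univ j⟩), hf i j]

/-- A Fekete set consists of distinct points, and each of its points `ζ j` maximizes the weighted
polynomial `z ↦ ∏ (z - ζ k) ^ 2 * exp (-n Q(z))`, the product being over `k ≠ j`. -/
theorem IsFeketeSet.properties {Q : ℂ → EReal} (hQ : IsExternalPotential Q)
    (hint : (interior (finiteSet Q)).Nonempty) {n : ℕ} {ζ : Fin n → ℂ} (hζ : IsFeketeSet Q ζ) :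
    Function.Injective ζ ∧ (∀ j, ζ j ∈ finiteSet Q) ∧
    ∀ j, ∀ z ∈ finiteSet Q, (∀ k ∈ Finset.univ.erase j, z ≠ ζ k) →
      ∑ k ∈ Finset.univ.erase j, 2 * Real.log ‖z - ζ k‖ - n * (Q z).toReal ≤
      ∑ k ∈ Finset.univ.erase j, 2 * Real.log ‖ζ j - ζ k‖ - n * (Q (ζ j)).toReal := by
  have hinf : (interior (finiteSet Q)).Infinite :=
    infinite_of_mem_nhds hint.some (isOpen_interior.mem_nhds hint.some_mem)
  have := hinf.to_subtype
  obtain ⟨e⟩ : Nonempty (Fin n ↪ interior (finiteSet Q)) :=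
    ⟨(Fin.valEmbedding).trans (Infinite.natEmbedding _)⟩
  have hgood := energy_eq hQ (ζ := fun i => (e i : ℂ))
    (Subtype.val_injective.comp e.injective) fun j => interior_subset (e j).2
  have htop : energy Q ζ ≠ ⊤ := by
    refine ne_top_of_le_ne_top ?_ (hζ fun i => (e i : ℂ))
    rw [hgood]; exact EReal.coe_ne_top _
  obtain ⟨hinj, hfin⟩ := injective_and_mem_of_energy_ne_top hQ htop
  refine ⟨hinj, hfin, fun j z hz hne => ?_⟩
  set η := Function.update ζ j z with hη
  have hηj : η j = z := by simp [hη]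
  have hηk : ∀ k, k ≠ j → η k = ζ k := fun k hk => by simp [hη, hk]
  have hηinj : Function.Injective η := by
    intro a b hab
    by_cases ha : a = j <;> by_cases hb : b = j
    · rw [ha, hb]
    · rw [ha, hηj, hηk b hb] at hab
      exact absurd hab (hne b (by simp [hb]))
    · rw [hb, hηj, hηk a ha] at hab
      exact absurd hab.symm (hne a (by simp [ha]))
    · rw [hηk a ha, hηk b hb] at hab; exact hinj hab
  have hηfin : ∀ k, η k ∈ finiteSet Q := by
    intro k
    by_cases hk : k = j
    · rw [hk, hηj]; exact hz
    · rw [hηk k hk]; exact hfin k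
  have h := hζ η
  rw [energy_eq hQ hinj hfin, energy_eq hQ hηinj hηfin, EReal.coe_le_coe_iff,
    sum_sum_erase_eq (fun i k => by rw [norm_sub_rev]) j,
    sum_sum_erase_eq (fun i k => by rw [norm_sub_rev]) j,
    ← Finset.add_sum_erase _ (fun j => (Q (ζ j)).toReal) (Finset.mem_univ j),
    ← Finset.add_sum_erase _ (fun j => (Q (η j)).toReal) (Finset.mem_univ j)] at h
  have e1 : ∑ k ∈ Finset.univ.erase j, -Real.log ‖η j - η k‖ =
      ∑ k ∈ Finset.univ.erase j, -Real.log ‖z - ζ k‖ :=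
    Finset.sum_congr rfl fun k hk => by rw [hηj, hηk k (Finset.ne_of_mem_erase hk)]
  have e2 : ∑ i ∈ Finset.univ.erase j, ∑ k ∈ (Finset.univ.erase i).erase j,
      -Real.log ‖η i - η k‖ = ∑ i ∈ Finset.univ.erase j, ∑ k ∈ (Finset.univ.erase i).erase j,
      -Real.log ‖ζ i - ζ k‖ :=
    Finset.sum_congr rfl fun i hi => Finset.sum_congr rfl fun k hk => by
      rw [hηk i (Finset.ne_of_mem_erase hi), hηk k (Finset.ne_of_mem_erase hk)]
  have e3 : ∑ i ∈ Finset.univ.erase j, (Q (η i)).toReal =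
      ∑ i ∈ Finset.univ.erase j, (Q (ζ i)).toReal :=
    Finset.sum_congr rfl fun i hi => by rw [hηk i (Finset.ne_of_mem_erase hi)]
  rw [e1, e2, e3, hηj] at h
  simp only [Finset.sum_neg_distrib] at h
  rw [← Finset.mul_sum, ← Finset.mul_sum]
  linarith

/-! ### The maximum principle for weighted polynomials -/

section

/-- The weighted polynomial `∏ |z - ζ k| ^ 2 * exp (-2 n V(z))`, where `V` is the logarithmic
potential of `σ`. For fewer than `n` factors it vanishes at infinity. -/
noncomputable def weightedPoly {ι : Type*} (σ : Measure ℂ) (s : Finset ι) (ζ : ι → ℂ) (n : ℕ)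
    (z : ℂ) : ℝ :=
  ‖∏ k ∈ s, (z - ζ k)‖ ^ 2 * Real.exp (-(2 * n * logPot σ z))

variable {ι : Type*} {Q : ℂ → EReal} {σ : Measure ℂ} {γ : ℝ}

theorem IsFrostman.continuous_weightedPoly (hσ : IsFrostman Q σ γ) (s : Finset ι) (ζ : ι → ℂ)
    (n : ℕ) : Continuous (weightedPoly σ s ζ n) := by
  have := hσ.continuous
  unfold weightedPoly
  fun_prop

theorem weightedPoly_nonneg (s : Finset ι) (ζ : ι → ℂ) (n : ℕ) (z : ℂ) :
    0 ≤ weightedPoly σ s ζ n z := by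
  unfold weightedPoly; positivity

theorem weightedPoly_pos_iff {s : Finset ι} {ζ : ι → ℂ} {n : ℕ} {z : ℂ} :
    0 < weightedPoly σ s ζ n z ↔ ∀ k ∈ s, z ≠ ζ k := by
  unfold weightedPoly
  rw [mul_pos_iff_of_pos_right (Real.exp_pos _), sq_pos_iff, norm_ne_zero_iff,
    Finset.prod_ne_zero_iff]
  simp only [sub_ne_zero]

theorem log_weightedPoly {s : Finset ι} {ζ : ι → ℂ} {n : ℕ} {z : ℂ} (hz : ∀ k ∈ s, z ≠ ζ k) :
    Real.log (weightedPoly σ s ζ n z) =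
      ∑ k ∈ s, 2 * Real.log ‖z - ζ k‖ - 2 * n * logPot σ z := by
  have h : ∀ k ∈ s, ‖z - ζ k‖ ≠ 0 := fun k hk => norm_ne_zero_iff.2 (sub_ne_zero.2 (hz k hk))
  unfold weightedPoly
  rw [norm_prod, Real.log_mul (pow_ne_zero _ (Finset.prod_ne_zero_iff.2 h)) (Real.exp_ne_zero _),
    Real.log_exp, Real.log_pow, Real.log_prod h, Finset.mul_sum]
  push_cast
  ring

theorem IsFrostman.tendsto_weightedPoly (hσ : IsFrostman Q σ γ) {s : Finset ι} (ζ : ι → ℂ)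
    {n : ℕ} (hs : s.card < n) : Tendsto (weightedPoly σ s ζ n) (cocompact ℂ) (𝓝 0) := by
  have hP := hσ.prob
  obtain ⟨R, hR⟩ := hσ.compact.isBounded.exists_norm_le
  obtain ⟨M, hM⟩ : ∃ M : ℝ, ∀ k ∈ s, ‖ζ k‖ ≤ M := by
    obtain ⟨M, hM⟩ := (s.finite_toSet.image ζ).isBounded.exists_norm_le
    exact ⟨M, fun k hk => hM _ ⟨k, hk, rfl⟩⟩
  have hlim : Tendsto (fun z : ℂ => (2 ^ (4 * n) : ℝ) * (‖z‖⁻¹)) (cocompact ℂ) (𝓝 0) := by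
    simpa using (tendsto_inv_atTop_zero.comp (tendsto_norm_cocompact_atTop (E := ℂ))).const_mul
      (2 ^ (4 * n) : ℝ)
  have hlarge : ∀ᶠ z : ℂ in cocompact ℂ, max (max (2 * R) M) 1 ≤ ‖z‖ :=
    tendsto_norm_cocompact_atTop.eventually (eventually_ge_atTop _)
  refine squeeze_zero' (Eventually.of_forall fun z => weightedPoly_nonneg s ζ n z) ?_ hlim
  filter_upwards [hlarge] with z hz
  have h1 : 1 ≤ ‖z‖ := (le_max_right _ _).trans hz
  have hzM : M ≤ ‖z‖ := ((le_max_right _ _).trans (le_max_left _ _)).trans hz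
  have hzR : 2 * R ≤ ‖z‖ := ((le_max_left _ _).trans (le_max_left _ _)).trans hz
  have hV : Real.log (‖z‖ / 2) ≤ logPot σ z := by
    calc Real.log (‖z‖ / 2) = ∫ _, Real.log (‖z‖ / 2) ∂σ := by simp
      _ ≤ ∫ w, Real.log ‖z - w‖ ∂σ := by
        refine integral_mono_ae (integrable_const _) (hσ.integrable z) ?_
        filter_upwards [ae_mem_support σ] with w hw
        refine Real.log_le_log (by positivity) ?_
        have := norm_sub_norm_le z w
        have := hR w hw
        linarith
  have hexp : Real.exp (-(2 * n * logPot σ z)) ≤ (2 / ‖z‖) ^ (2 * n) := by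
    have h2 : 2 / ‖z‖ = Real.exp (-Real.log (‖z‖ / 2)) := by
      rw [Real.exp_neg, Real.exp_log (by positivity), inv_div]
    rw [h2, ← Real.exp_nat_mul]
    refine Real.exp_le_exp.2 ?_
    push_cast
    have : (2 * n : ℝ) * Real.log (‖z‖ / 2) ≤ 2 * n * logPot σ z := by gcongr
    linarith
  have hprod : ‖∏ k ∈ s, (z - ζ k)‖ ≤ (2 * ‖z‖) ^ s.card := by
    rw [norm_prod, ← Finset.prod_const]
    refine Finset.prod_le_prod (fun _ _ => norm_nonneg _) fun k hk => ?_
    have := norm_sub_le z (ζ k)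
    have := hM k hk
    linarith
  calc weightedPoly σ s ζ n z
      ≤ ((2 * ‖z‖) ^ s.card) ^ 2 * (2 / ‖z‖) ^ (2 * n) := by
        unfold weightedPoly; gcongr
    _ ≤ ((2 * ‖z‖) ^ (n - 1)) ^ 2 * (2 / ‖z‖) ^ (2 * n) := by
        gcongr
        · linarith
        · omega
    _ ≤ 2 ^ (4 * n) * ‖z‖⁻¹ := by
        obtain ⟨m, rfl⟩ : ∃ m, n = m + 1 := ⟨n - 1, by omega⟩
        have hz0 : ‖z‖ ≠ 0 := by positivity
        have e : ((2 * ‖z‖) ^ (m + 1 - 1)) ^ 2 * (2 / ‖z‖) ^ (2 * (m + 1)) =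
            2 ^ (4 * m + 2) * (‖z‖⁻¹ * ‖z‖⁻¹) := by
          rw [Nat.add_sub_cancel, ← pow_mul, mul_pow, div_pow]
          field_simp
          ring
        rw [e]
        have hinv : ‖z‖⁻¹ ≤ 1 := inv_le_one_of_one_le₀ h1
        have hinv0 : 0 ≤ ‖z‖⁻¹ := by positivity
        have hpow : (2 : ℝ) ^ (4 * m + 2) ≤ 2 ^ (4 * (m + 1)) :=
          pow_le_pow_right₀ (by norm_num) (by omega)
        calc (2 : ℝ) ^ (4 * m + 2) * (‖z‖⁻¹ * ‖z‖⁻¹)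
            ≤ 2 ^ (4 * (m + 1)) * (‖z‖⁻¹ * 1) := by gcongr
          _ = _ := by ring

/-- If a weighted polynomial attains its maximum in a disk on which the potential is the real part
of a holomorphic function, then it is constant on the disk. -/
theorem weightedPoly_eq_of_isMax {s : Finset ι} {ζ : ι → ℂ} {n : ℕ} {z₀ y : ℂ} {r : ℝ}
    {h : ℂ → ℂ} (hh : DifferentiableOn ℂ h (Metric.ball z₀ r))
    (hre : ∀ z ∈ Metric.ball z₀ r, logPot σ z = (h z).re) (hy : y ∈ Metric.ball z₀ r)
    (hmax : ∀ z, weightedPoly σ s ζ n z ≤ weightedPoly σ s ζ n y) :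
    ∀ z ∈ Metric.ball z₀ r, weightedPoly σ s ζ n z = weightedPoly σ s ζ n y := by
  set G : ℂ → ℂ := fun z => (∏ k ∈ s, (z - ζ k)) * Complex.exp (-(n * h z)) with hG
  have hGn : ∀ z ∈ Metric.ball z₀ r, weightedPoly σ s ζ n z = ‖G z‖ ^ 2 := by
    intro z hz
    rw [hG, norm_mul, Complex.norm_exp, weightedPoly, mul_pow, ← Real.exp_nat_mul, hre z hz]
    congr 2
    simp
    ring
  have hGd : DifferentiableOn ℂ G (Metric.ball z₀ r) := by
    refine DifferentiableOn.mul ?_ ((hh.const_mul _).neg.cexp)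
    fun_prop
  have hM : IsMaxOn (norm ∘ G) (Metric.ball z₀ r) y := by
    intro z hz
    have := hmax z
    rw [hGn z hz, hGn y hy] at this
    exact (sq_le_sq₀ (norm_nonneg _) (norm_nonneg _)).1 this
  intro z hz
  have := Complex.norm_eqOn_of_isPreconnected_of_isMaxOn (convex_ball z₀ r).isPreconnected
    Metric.isOpen_ball hGd hy hM hz
  rw [hGn z hz, hGn y hy]
  simp only [Function.comp, Function.const] at this
  rw [this]

theorem IsFrostman.exists_ball_eq (hσ : IsFrostman Q σ γ) {s : Finset ι} {ζ : ι → ℂ} {n : ℕ}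
    {y : ℂ} (hy : y ∉ σ.support) (hmax : ∀ z, weightedPoly σ s ζ n z ≤ weightedPoly σ s ζ n y) :
    ∃ r > 0, Metric.ball y r ⊆ σ.supportᶜ ∧
      ∀ z ∈ Metric.ball y r, weightedPoly σ s ζ n z = weightedPoly σ s ζ n y := by
  have := hσ.prob
  obtain ⟨r, hr, hsub, h, hh, hre⟩ := exists_holomorphic_re_eq hσ.compact hσ.integrable hy
  exact ⟨r, hr, hsub, weightedPoly_eq_of_isMax hh hre (Metric.mem_ball_self hr) hmax⟩

/-- A bound for a weighted polynomial on the droplet holds in the whole plane. -/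
theorem IsFrostman.weightedPoly_le (hσ : IsFrostman Q σ γ) {s : Finset ι} {ζ : ι → ℂ} {n : ℕ}
    (hs : s.card < n) {M : ℝ} (hM : ∀ z ∈ σ.support, weightedPoly σ s ζ n z ≤ M) (z : ℂ) :
    weightedPoly σ s ζ n z ≤ M := by
  have hc := hσ.continuous_weightedPoly s ζ n
  by_cases hz : weightedPoly σ s ζ n z ≤ 0
  · obtain ⟨a, ha⟩ := hσ.nonempty
    exact hz.trans ((weightedPoly_nonneg s ζ n a).trans (hM a ha))
  push Not at hz
  obtain ⟨y, hy⟩ := hc.exists_forall_ge' z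
    ((hσ.tendsto_weightedPoly ζ hs).eventually (ge_mem_nhds hz))
  refine (hy z).trans ?_
  by_contra! hcon
  set E := {x | weightedPoly σ s ζ n x = weightedPoly σ s ζ n y} with hE
  have hES : ∀ x ∈ E, x ∉ σ.support := by
    intro x hx hxS
    have := hM x hxS
    rw [show weightedPoly σ s ζ n x = weightedPoly σ s ζ n y from hx] at this
    exact absurd this (not_le.2 hcon)
  have hclosed : IsClosed E := isClosed_eq hc continuous_const
  have hopen : IsOpen E := by
    rw [Metric.isOpen_iff]
    intro x hx
    have hxy : weightedPoly σ s ζ n x = weightedPoly σ s ζ n y := hx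
    obtain ⟨r, hr, -, heq⟩ := hσ.exists_ball_eq (hES x hx) (fun z => (hy z).trans hxy.ge)
    exact ⟨r, hr, fun z hz => (heq z hz).trans hxy⟩
  have huniv : E = Set.univ := IsClopen.eq_univ ⟨hclosed, hopen⟩ ⟨y, rfl⟩
  obtain ⟨a, ha⟩ := hσ.nonempty
  exact hES a (huniv ▸ Set.mem_univ a) ha

/-! ### Localization of the Fekete points -/

/-- The weighted polynomial attached to a Fekete point at which `γ + 2 V ≤ Q` has its global maximum
at this point. -/
theorem IsFrostman.weightedPoly_le_of_isFeketeSet (hσ : IsFrostman Q σ γ)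
    (hQ : IsExternalPotential Q) (hS : σ.support ⊆ interior (finiteSet Q)) {n : ℕ} {ζ : Fin n → ℂ}
    (hζ : IsFeketeSet Q ζ) {j : Fin n} (hj : γ + 2 * logPot σ (ζ j) ≤ (Q (ζ j)).toReal) :
    0 < weightedPoly σ (Finset.univ.erase j) ζ n (ζ j) ∧
    ∀ z, weightedPoly σ (Finset.univ.erase j) ζ n z ≤
      weightedPoly σ (Finset.univ.erase j) ζ n (ζ j) := by
  obtain ⟨hinj, hfin, hle⟩ := hζ.properties hQ (hσ.nonempty.mono hS)
  have hcard : (Finset.univ.erase j).card < n := by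
    rw [Finset.card_erase_of_mem (Finset.mem_univ j), Finset.card_univ, Fintype.card_fin]
    have := j.pos
    omega
  have hjne : ∀ k ∈ Finset.univ.erase j, ζ j ≠ ζ k := fun k hk h =>
    Finset.ne_of_mem_erase hk (hinj h).symm
  have hpos := weightedPoly_pos_iff (σ := σ) (n := n) |>.2 hjne
  refine ⟨hpos, hσ.weightedPoly_le hcard fun z hz => ?_⟩
  by_cases hne : ∀ k ∈ Finset.univ.erase j, z ≠ ζ k
  · rw [← Real.log_le_log_iff (weightedPoly_pos_iff.2 hne) hpos, log_weightedPoly hne,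
      log_weightedPoly hjne]
    have h1 := hle j z (interior_subset (hS hz)) hne
    rw [hσ.eq z hz] at h1
    have h2 : (n : ℝ) * (γ + 2 * logPot σ (ζ j)) ≤ n * (Q (ζ j)).toReal := by gcongr
    linarith
  · have h0 := mt (weightedPoly_pos_iff (σ := σ) (n := n)).1 hne
    exact (not_lt.1 h0).trans hpos.le

/-- If a weighted polynomial attains its maximum off the droplet, then it does so at some point
outside the region `U` of strict subharmonicity, and this point is no further from the origin than
the droplet. -/
theorem IsFrostman.exists_isMax_notMem (hσ : IsFrostman Q σ γ) (hQ : IsExternalPotential Q)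
    {U : Set ℂ} (hUi : U ⊆ interior (finiteSet Q)) (hlap : ∀ z ∈ U, 0 < lap Q z) {R : ℝ}
    (hR : ∀ z ∈ σ.support, ‖z‖ ≤ R) {s : Finset ι} {ζ : ι → ℂ} {n : ℕ} (hs : s.card < n) {y : ℂ}
    (hy : y ∉ σ.support) (hpos : 0 < weightedPoly σ s ζ n y)
    (hmax : ∀ z, weightedPoly σ s ζ n z ≤ weightedPoly σ s ζ n y) :
    ∃ x, ‖x‖ ≤ R ∧ x ∉ U ∧ weightedPoly σ s ζ n x = weightedPoly σ s ζ n y := by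
  have hP := hσ.prob
  have hc := hσ.continuous_weightedPoly s ζ n
  set m := weightedPoly σ s ζ n y with hm
  set E := {x | weightedPoly σ s ζ n x = m} with hE
  have hclosed : IsClosed E := isClosed_eq hc continuous_const
  have hcompact : IsCompact E := by
    have h1 := (hσ.tendsto_weightedPoly ζ hs).eventually (gt_mem_nhds hpos)
    obtain ⟨t, ht, hts⟩ := mem_cocompact.1 h1
    refine ht.of_isClosed_subset hclosed fun x hx => ?_
    by_contra hxt
    have : weightedPoly σ s ζ n x < m := hts hxt
    exact this.ne hx
  have hloc : ∀ x ∈ E, x ∉ σ.support → ∃ r > 0, Metric.ball x r ⊆ E := by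
    intro x hx hxS
    have hxy : weightedPoly σ s ζ n x = m := hx
    obtain ⟨r, hr, -, heq⟩ := hσ.exists_ball_eq hxS (fun z => (hmax z).trans hxy.ge)
    exact ⟨r, hr, fun z hz => (heq z hz).trans hxy⟩
  have hER : ∀ x ∈ E, ‖x‖ ≤ R := by
    -- a point of largest modulus of `E` lies in the droplet
    obtain ⟨x, hx, hxmax⟩ := hcompact.exists_isMaxOn ⟨y, rfl⟩ continuous_norm.continuousOn
    have hxR : ‖x‖ ≤ R := by
      by_cases hxS : x ∈ σ.support
      · exact hR x hxS
      exfalso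
      obtain ⟨r, hr, hball⟩ := hloc x hx hxS
      obtain ⟨v, hv1, hv2⟩ : ∃ v : ℂ, ‖v‖ < r ∧ ‖x‖ < ‖x + v‖ := by
        by_cases hx0 : x = 0
        · refine ⟨((r / 2 : ℝ) : ℂ), ?_, ?_⟩
          · rw [Complex.norm_real, Real.norm_eq_abs, abs_of_pos (by positivity)]; linarith
          · rw [hx0, zero_add, norm_zero, norm_pos_iff]
            exact_mod_cast (by positivity : r / 2 ≠ 0)
        · have hx0' : 0 < ‖x‖ := norm_pos_iff.2 hx0
          refine ⟨((r / (2 * ‖x‖) : ℝ) : ℂ) * x, ?_, ?_⟩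
          · rw [norm_mul, Complex.norm_real, Real.norm_eq_abs, abs_of_pos (by positivity)]
            field_simp
            linarith
          · have : x + ((r / (2 * ‖x‖) : ℝ) : ℂ) * x = ((1 + r / (2 * ‖x‖) : ℝ) : ℂ) * x := by
              push_cast; ring
            rw [this, norm_mul, Complex.norm_real, Real.norm_eq_abs, abs_of_pos (by positivity)]
            have : 0 < r / (2 * ‖x‖) := by positivity
            nlinarith
      have h3 : x + v ∈ E := hball (by simpa [Metric.mem_ball, dist_eq_norm] using hv1)
      exact absurd (hxmax h3) (not_le.2 hv2)
    exact fun z hz => (hxmax hz).trans hxR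
  by_contra! hcon
  have hEU : E ⊆ U := fun x hx => by
    by_contra hxU
    exact hcon x (hER x hx) hxU hx
  -- `Q - γ - 2 V` vanishes on the droplet and is nonnegative on `E`, so that it attains its maximum
  -- over `E` off the droplet; there it would be strictly subharmonic
  set g : ℂ → ℝ := fun z => (Q z).toReal - γ - 2 * logPot σ z with hg
  have hgc : ContinuousOn g E := by
    intro x hx
    refine ContinuousAt.continuousWithinAt ?_
    have h1 := hQ.continuousAt (hUi (hEU hx))
    have h2 := hσ.continuous.continuousAt (x := x)
    exact (h1.sub continuousAt_const).sub (h2.const_mul 2)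
  have hg0 : ∀ x ∈ E, 0 ≤ g x := fun x hx => by
    have := hσ.le x (hUi (hEU hx)); simp only [hg]; linarith
  obtain ⟨a, haE, haS, hamax⟩ : ∃ a ∈ E, a ∉ σ.support ∧ ∀ x ∈ E, g x ≤ g a := by
    obtain ⟨a, haE, hamax⟩ := hcompact.exists_isMaxOn ⟨y, rfl⟩ hgc
    by_cases haS : a ∈ σ.support
    · refine ⟨y, rfl, hy, fun x hx => (hamax hx).trans ?_⟩
      have : g a = 0 := by simp only [hg]; rw [hσ.eq a haS]; ring
      rw [this]
      exact hg0 y rfl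
    · exact ⟨a, haE, haS, hamax⟩
  obtain ⟨r₁, hr₁, hball⟩ := hloc a haE haS
  have hEne : ∀ x ∈ E, ∀ k ∈ s, x ≠ ζ k := fun x hx => weightedPoly_pos_iff.1 (by
    rw [show weightedPoly σ s ζ n x = m from hx]; exact hpos)
  have hrk : ∀ k ∈ s, r₁ ≤ ‖a - ζ k‖ := by
    intro k hk
    by_contra! h
    exact hEne (ζ k) (hball (by rwa [Metric.mem_ball, dist_comm, dist_eq_norm])) k hk rfl
  have hla := hlap a (hEU haE)
  have hQm : Measurable fun z => (Q z).toReal :=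
    hQ.lowerSemicontinuous.measurable.ereal_toReal
  obtain ⟨r₀, hr₀, hexp⟩ := circleMeasure_expansion (K := {a}) hQm isOpen_interior
    (hQ.analytic.contDiffOn isOpen_interior.uniqueDiffOn) isCompact_singleton
    (Set.singleton_subset_iff.2 (hUi (hEU haE))) (half_pos hla)
  obtain ⟨r, hr, hrr⟩ : ∃ r, 0 < r ∧ r < min r₀ r₁ := exists_between (lt_min hr₀ hr₁)
  have hr0 := hrr.trans_le (min_le_left _ _)
  have hr1 := hrr.trans_le (min_le_right _ _)
  obtain ⟨-, hQi, hQe⟩ := hexp a rfl r hr hr0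
  have hPc := isProbabilityMeasure_circleMeasure a r
  have hn : (0 : ℝ) < n := by exact_mod_cast (Nat.zero_le _).trans_lt hs
  have hVeq : ∀ x ∈ E, 2 * logPot σ x =
      (∑ k ∈ s, 2 * Real.log ‖x - ζ k‖ - Real.log m) / n := by
    intro x hx
    have := log_weightedPoly (σ := σ) (n := n) (hEne x hx)
    rw [show weightedPoly σ s ζ n x = m from hx] at this
    rw [this]; field_simp; ring
  have hcircE : ∀ᵐ x ∂circleMeasure a r, x ∈ E := by
    filter_upwards [ae_circleMeasure_norm a hr] with x hx
    exact hball (by rw [Metric.mem_ball, dist_eq_norm, hx]; exact hr1)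
  have hlogi : Integrable (fun x => ∑ k ∈ s, 2 * Real.log ‖x - ζ k‖) (circleMeasure a r) :=
    integrable_finsetSum _ fun k _ => (integrable_log_circleMeasure a (ζ k) r).const_mul 2
  have hlogv : ∫ x, ∑ k ∈ s, 2 * Real.log ‖x - ζ k‖ ∂circleMeasure a r =
      ∑ k ∈ s, 2 * Real.log ‖a - ζ k‖ := by
    rw [integral_finsetSum _ fun k _ => (integrable_log_circleMeasure a (ζ k) r).const_mul 2]
    refine Finset.sum_congr rfl fun k hk => ?_
    rw [integral_const_mul, integral_log_circleMeasure a (ζ k) hr,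
      max_eq_right (hr1.le.trans (hrk k hk))]
  have hVi : Integrable (fun x => 2 * logPot σ x) (circleMeasure a r) :=
    (integrable_circleMeasure_of_continuous hσ.continuous hr).const_mul 2
  have hVv : ∫ x, 2 * logPot σ x ∂circleMeasure a r = 2 * logPot σ a := by
    rw [hVeq a haE, ← hlogv]
    have : ∫ x, 2 * logPot σ x ∂circleMeasure a r =
        ∫ x, (∑ k ∈ s, 2 * Real.log ‖x - ζ k‖ - Real.log m) / n ∂circleMeasure a r :=
      integral_congr_ae (hcircE.mono fun x hx => hVeq x hx)
    rw [this, integral_div, integral_sub hlogi (integrable_const _)]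
    simp
  have hle : ∫ x, g x ∂circleMeasure a r ≤ g a := by
    have hQi' : Integrable (fun x => (Q x).toReal - γ) (circleMeasure a r) :=
      hQi.sub (integrable_const γ)
    calc ∫ x, g x ∂circleMeasure a r ≤ ∫ _, g a ∂circleMeasure a r :=
          integral_mono_ae (hQi'.sub hVi) (integrable_const _)
            (hcircE.mono fun x hx => hamax x hx)
      _ = g a := by simp
  have hval : ∫ x, g x ∂circleMeasure a r =
      ∫ x, (Q x).toReal ∂circleMeasure a r - γ - 2 * logPot σ a := by
    have hQi' : Integrable (fun x => (Q x).toReal - γ) (circleMeasure a r) :=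
      hQi.sub (integrable_const γ)
    simp only [hg]
    rw [integral_sub hQi' hVi, integral_sub hQi (integrable_const γ), hVv]
    simp
  rw [hval] at hle
  have h1 := (abs_le.1 hQe).1
  change -(lap Q a / 2 * r ^ 2) ≤ _ - _ - r ^ 2 * lap Q a at h1
  have h2 : 0 < lap Q a * r ^ 2 := by positivity
  simp only [hg] at hle
  nlinarith

/-- Weighted polynomials with different exponents cannot both be constant on the same disk, if the
number of factors is one less than the exponent. -/
theorem eq_of_weightedPoly_const {ι' : Type*} {s : Finset ι} {t : Finset ι'} {ζ : ι → ℂ}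
    {η : ι' → ℂ} {n m : ℕ} (hs : s.card + 1 = n) (ht : t.card + 1 = m) {z₀ : ℂ} {r c d : ℝ}
    (hr : 0 < r) (hc : 0 < c) (hd : 0 < d)
    (hn : ∀ z ∈ Metric.ball z₀ r, weightedPoly σ s ζ n z = c)
    (hm : ∀ z ∈ Metric.ball z₀ r, weightedPoly σ t η m z = d) : n = m := by
  set p : ℂ → ℂ := fun z => ∏ k ∈ s, (z - ζ k) with hp
  set q : ℂ → ℂ := fun z => ∏ k ∈ t, (z - η k) with hq
  have hq0 : ∀ z ∈ Metric.ball z₀ r, q z ≠ 0 := by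
    intro z hz h
    have := hm z hz
    unfold weightedPoly at this
    rw [show ∏ k ∈ t, (z - η k) = 0 from h] at this
    simp at this
    exact hd.ne this
  have hz₀ := Metric.mem_ball_self hr (x := z₀)
  have hnorm : ∀ z ∈ Metric.ball z₀ r, ‖p z ^ m / q z ^ n‖ ^ 2 = c ^ m / d ^ n := by
    intro z hz
    rw [← hn z hz, ← hm z hz]
    unfold weightedPoly
    rw [mul_pow, mul_pow, ← Real.exp_nat_mul, ← Real.exp_nat_mul,
      show (m : ℝ) * -(2 * n * logPot σ z) = n * -(2 * m * logPot σ z) by ring,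
      mul_div_mul_right _ _ (Real.exp_ne_zero _), norm_div, norm_pow, norm_pow, div_pow]
    congr 1 <;> ring
  have hdiff : DifferentiableOn ℂ (fun z => p z ^ m / q z ^ n) (Metric.ball z₀ r) := by
    refine DifferentiableOn.div ?_ ?_ fun z hz => pow_ne_zero _ (hq0 z hz) <;> fun_prop
  have hconst := Complex.eqOn_of_isPreconnected_of_isMaxOn_norm (convex_ball z₀ r).isPreconnected
    Metric.isOpen_ball hdiff hz₀ (fun z hz => by
      have := (hnorm z hz).trans (hnorm z₀ hz₀).symm
      exact ((sq_eq_sq₀ (norm_nonneg _) (norm_nonneg _)).1 this).le)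
  set κ := p z₀ ^ m / q z₀ ^ n with hκ
  have hκ0 : κ ≠ 0 := by
    intro h
    have := hnorm z₀ hz₀
    rw [← hκ, h, norm_zero, zero_pow two_ne_zero] at this
    exact (by positivity : (0 : ℝ) < c ^ m / d ^ n).ne this
  set P : Polynomial ℂ := ∏ k ∈ s, (Polynomial.X - Polynomial.C (ζ k)) with hP
  set T : Polynomial ℂ := ∏ k ∈ t, (Polynomial.X - Polynomial.C (η k)) with hT
  have hpoly : P ^ m = Polynomial.C κ * T ^ n := by
    refine Polynomial.eq_of_infinite_eval_eq _ _
      ((infinite_of_mem_nhds z₀ (Metric.isOpen_ball.mem_nhds hz₀)).mono fun z hz => ?_)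
    have h1 : p z ^ m / q z ^ n = κ := hconst hz
    rw [div_eq_iff (pow_ne_zero _ (hq0 z hz))] at h1
    simpa [hP, hT, Polynomial.eval_prod, hp, hq] using h1
  have hdeg := congrArg Polynomial.natDegree hpoly
  rw [Polynomial.natDegree_C_mul hκ0, Polynomial.natDegree_pow, Polynomial.natDegree_pow, hP, hT,
    Polynomial.natDegree_finsetProd_X_sub_C_eq_card,
    Polynomial.natDegree_finsetProd_X_sub_C_eq_card] at hdeg
  subst hs ht
  nlinarith

/-- For large `n`, the Fekete points at which `γ + 2 V ≤ Q` belong to the droplet. -/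
theorem IsFrostman.eventually_mem_support (hσ : IsFrostman Q σ γ) (hQ : IsExternalPotential Q)
    {U : Set ℂ} (hUo : IsOpen U) (hSU : σ.support ⊆ U) (hUi : U ⊆ interior (finiteSet Q))
    (hlap : ∀ z ∈ U, 0 < lap Q z) {F : (n : ℕ) → Fin n → ℂ} (hF : ∀ n, IsFeketeSet Q (F n)) :
    ∀ᶠ n : ℕ in atTop, ∀ j, γ + 2 * logPot σ (F n j) ≤ (Q (F n j)).toReal →
      F n j ∈ σ.support := by
  have hP := hσ.prob
  by_contra hcon
  obtain ⟨φ, hφ, hbad⟩ := extraction_of_frequently_atTop (not_eventually.1 hcon)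
  push Not at hbad
  choose j hj hjS using hbad
  obtain ⟨R, hR⟩ := hσ.compact.isBounded.exists_norm_le
  have hcard : ∀ i, (Finset.univ.erase (j i)).card + 1 = φ i := by
    intro i
    rw [Finset.card_erase_of_mem (Finset.mem_univ (j i)), Finset.card_univ, Fintype.card_fin]
    have := (j i).pos
    omega
  have hmax := fun i => hσ.weightedPoly_le_of_isFeketeSet hQ (hSU.trans hUi) (hF (φ i)) (hj i)
  have hex := fun i => hσ.exists_isMax_notMem hQ hUi hlap hR
    (s := Finset.univ.erase (j i)) (ζ := F (φ i)) (n := φ i) (by have := hcard i; omega)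
    (hjS i) (hmax i).1 (hmax i).2
  choose y hyR hyU hy using hex
  have hK : IsCompact (Metric.closedBall (0 : ℂ) R \ U) := (isCompact_closedBall 0 R).diff hUo
  obtain ⟨x, hx, ψ, hψ, hlim⟩ := hK.tendsto_subseq (x := y)
    fun i => ⟨mem_closedBall_zero_iff.2 (hyR i), hyU i⟩
  obtain ⟨r, hr, -, h, hh, hre⟩ := exists_holomorphic_re_eq hσ.compact hσ.integrable
    (fun hxS => hx.2 (hSU hxS))
  obtain ⟨N, hN⟩ := (hlim.eventually (Metric.isOpen_ball.mem_nhds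
    (Metric.mem_ball_self hr (x := x)))).exists_forall_of_atTop
  have hconst : ∀ i, N ≤ i → ∀ z ∈ Metric.ball x r,
      weightedPoly σ (Finset.univ.erase (j (ψ i))) (F (φ (ψ i))) (φ (ψ i)) z =
      weightedPoly σ (Finset.univ.erase (j (ψ i))) (F (φ (ψ i))) (φ (ψ i)) (y (ψ i)) := fun i hi =>
    weightedPoly_eq_of_isMax hh hre (hN i hi) fun z => (hy (ψ i)) ▸ (hmax (ψ i)).2 z
  have heq := eq_of_weightedPoly_const (hcard (ψ N)) (hcard (ψ (N + 1))) hr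
    ((hy (ψ N)) ▸ (hmax (ψ N)).1) ((hy (ψ (N + 1))) ▸ (hmax (ψ (N + 1))).1)
    (hconst N le_rfl) (hconst (N + 1) (by omega))
  have := hψ.injective (hφ.injective heq)
  omega

/-- If the potential does not jump down at the boundary, then `γ + 2 V ≤ Q` wherever `Q` is
finite. -/
theorem IsFrostman.le_of_noDownwardJump (hσ : IsFrostman Q σ γ) (hQ : IsExternalPotential Q)
    (hjump : NoDownwardJump Q) {z : ℂ} (hz : z ∈ finiteSet Q) :
    γ + 2 * logPot σ z ≤ (Q z).toReal := by
  by_cases hzi : z ∈ interior (finiteSet Q)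
  · exact hσ.le z hzi
  have : (𝓝[interior (finiteSet Q)] z).NeBot :=
    mem_closure_iff_nhdsWithin_neBot.1 (hQ.interior_dense hz)
  rw [← EReal.coe_le_coe_iff, toReal_coe_of_mem hQ hz]
  refine le_trans ?_ (hjump z hz hzi)
  have hc : Continuous fun w => ((γ + 2 * logPot σ w : ℝ) : EReal) :=
    continuous_coe_real_ereal.comp (continuous_const.add (hσ.continuous.const_mul 2))
  have h1 : liminf (fun w => ((γ + 2 * logPot σ w : ℝ) : EReal)) (𝓝[interior (finiteSet Q)] z) =
      ((γ + 2 * logPot σ z : ℝ) : EReal) :=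
    ((hc.tendsto z).mono_left nhdsWithin_le_nhds).liminf_eq
  rw [← h1]
  refine liminf_le_liminf ?_
  filter_upwards [self_mem_nhdsWithin] with w hw
  rw [← toReal_coe_of_mem hQ (interior_subset hw), EReal.coe_le_coe_iff]
  exact hσ.le w hw

end

/-! ### Separation of Fekete points -/

theorem IsExternalPotential.continuousOn_lap {Q : ℂ → EReal} (hQ : IsExternalPotential Q) :
    ContinuousOn (lap Q) (interior (finiteSet Q)) := by
  have h := (hQ.analytic.iteratedFDeriv 2).continuousOn
  unfold lap
  rw [InnerProductSpace.laplacian_eq_iteratedFDeriv_complexPlane]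
  have h1 : ∀ v : Fin 2 → ℂ, ContinuousOn
      (fun z => iteratedFDeriv ℝ 2 (fun w : ℂ => (Q w).toReal) z v) (interior (finiteSet Q)) :=
    fun v => (ContinuousMultilinearMap.apply ℝ (fun _ : Fin 2 => ℂ) ℝ v).continuous
      |>.comp_continuousOn h
  exact ((h1 _).add (h1 _)).div_const 4

/-- Jensen's inequality applied to the weighted polynomial of a Fekete point `ζ j`: another point
of the set near `ζ j` forces the circular means of `Q` about `ζ j` to exceed `Q (ζ j)`. -/
theorem IsFeketeSet.log_le_circleMean {Q : ℂ → EReal} (hQ : IsExternalPotential Q) {n : ℕ}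
    {ζ : Fin n → ℂ} (hζ : IsFeketeSet Q ζ) {j k : Fin n} (hjk : k ≠ j) {r : ℝ} (hr : 0 < r)
    (hball : Metric.closedBall (ζ j) r ⊆ interior (finiteSet Q))
    (hi : Integrable (fun z => (Q z).toReal) (circleMeasure (ζ j) r)) :
    2 * (Real.log r - Real.log ‖ζ j - ζ k‖) ≤
      n * (∫ z, (Q z).toReal ∂circleMeasure (ζ j) r - (Q (ζ j)).toReal) := by
  have hP := isProbabilityMeasure_circleMeasure (ζ j) r
  have hjmem := hball (Metric.mem_closedBall_self hr.le)
  obtain ⟨hinj, hfin, hle⟩ := hζ.properties hQ ⟨_, hjmem⟩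
  have hpos : ∀ i ∈ Finset.univ.erase j, 0 < ‖ζ j - ζ i‖ := fun i hi =>
    norm_pos_iff.2 (sub_ne_zero.2 fun h => Finset.ne_of_mem_erase hi (hinj h).symm)
  have hlogi : ∀ i ∈ Finset.univ.erase j,
      Integrable (fun z => 2 * Real.log ‖z - ζ i‖) (circleMeasure (ζ j) r) :=
    fun i _ => (integrable_log_circleMeasure (ζ j) (ζ i) r).const_mul 2
  have hsumi : Integrable (fun z => ∑ i ∈ Finset.univ.erase j, 2 * Real.log ‖z - ζ i‖)
      (circleMeasure (ζ j) r) := integrable_finsetSum _ hlogi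
  have hmean : ∫ z, (∑ i ∈ Finset.univ.erase j, 2 * Real.log ‖z - ζ i‖ - n * (Q z).toReal)
      ∂circleMeasure (ζ j) r ≤
      ∑ i ∈ Finset.univ.erase j, 2 * Real.log ‖ζ j - ζ i‖ - n * (Q (ζ j)).toReal := by
    calc _ ≤ ∫ _, (∑ i ∈ Finset.univ.erase j, 2 * Real.log ‖ζ j - ζ i‖ -
          n * (Q (ζ j)).toReal) ∂circleMeasure (ζ j) r := by
          refine integral_mono_ae (hsumi.sub (hi.const_mul n)) (integrable_const _) ?_
          have hne : ∀ᵐ z ∂circleMeasure (ζ j) r, ∀ i, z ≠ ζ i :=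
            ae_all_iff.2 fun i => ae_circleMeasure_ne _ hr _
          filter_upwards [ae_circleMeasure_norm (ζ j) hr, hne] with z hz hzne
          refine hle j z (interior_subset (hball ?_)) fun i _ => hzne i
          rw [Metric.mem_closedBall, dist_eq_norm, hz]
      _ = _ := by simp
  have hval : ∫ z, (∑ i ∈ Finset.univ.erase j, 2 * Real.log ‖z - ζ i‖ - n * (Q z).toReal)
      ∂circleMeasure (ζ j) r = ∑ i ∈ Finset.univ.erase j, 2 * Real.log (max r ‖ζ j - ζ i‖) -
      n * ∫ z, (Q z).toReal ∂circleMeasure (ζ j) r := by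
    rw [integral_sub hsumi (hi.const_mul n), integral_finsetSum _ hlogi, integral_const_mul]
    congr 1
    refine Finset.sum_congr rfl fun i _ => ?_
    rw [integral_const_mul, integral_log_circleMeasure _ _ hr]
  rw [hval] at hmean
  have hk := Finset.mem_erase.2 ⟨hjk, Finset.mem_univ k⟩
  have hsingle : 2 * Real.log (max r ‖ζ j - ζ k‖) - 2 * Real.log ‖ζ j - ζ k‖ ≤
      ∑ i ∈ Finset.univ.erase j,
        (2 * Real.log (max r ‖ζ j - ζ i‖) - 2 * Real.log ‖ζ j - ζ i‖) := by
    refine Finset.single_le_sum (f := fun i => 2 * Real.log (max r ‖ζ j - ζ i‖) -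
      2 * Real.log ‖ζ j - ζ i‖) (fun i hi => ?_) hk
    have := Real.log_le_log (hpos i hi) (le_max_right r ‖ζ j - ζ i‖)
    linarith
  rw [Finset.sum_sub_distrib] at hsingle
  have := Real.log_le_log hr (le_max_left r ‖ζ j - ζ k‖)
  linarith

/-- Fekete points in a compact set of positivity of the Laplacian are asymptotically separated with
constant at least `1 / √e`. -/
theorem eventually_separated {Q : ℂ → EReal} (hQ : IsExternalPotential Q) {K : Set ℂ}
    (hK : IsCompact K) (hKi : K ⊆ interior (finiteSet Q)) (hlap : ∀ z ∈ K, 0 < lap Q z)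
    {F : (n : ℕ) → Fin n → ℂ} (hF : ∀ n, IsFeketeSet Q (F n)) {δ : ℝ} (hδ : 0 < δ) :
    ∀ᶠ n : ℕ in atTop, ∀ j, F n j ∈ K → ∀ k, k ≠ j →
      (1 - δ) / √(Real.exp 1 * n * lap Q (F n j)) ≤ dist (F n k) (F n j) := by
  rcases K.eq_empty_or_nonempty with rfl | hne
  · simp
  obtain ⟨a, haK, hamin⟩ := hK.exists_isMinOn hne (hQ.continuousOn_lap.mono hKi)
  set c := lap Q a with hc
  have hc0 : 0 < c := hlap a haK
  have hQm : Measurable fun z => (Q z).toReal :=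
    hQ.lowerSemicontinuous.measurable.ereal_toReal
  obtain ⟨r₀, hr₀, hexp⟩ := circleMeasure_expansion hQm isOpen_interior
    (hQ.analytic.contDiffOn isOpen_interior.uniqueDiffOn) hK hKi
    (by positivity : 0 < 2 * δ * c)
  have hlarge : ∀ᶠ n : ℕ in atTop, 1 / (c * r₀ ^ 2) < n :=
    tendsto_natCast_atTop_atTop.eventually (eventually_gt_atTop _)
  filter_upwards [hlarge] with n hn j hj k hjk
  have hl : c ≤ lap Q (F n j) := hamin hj
  set l := lap Q (F n j) with hldef
  have hl0 : 0 < l := hc0.trans_le hl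
  have hn0 : (0 : ℝ) < n := lt_of_le_of_lt (by positivity) hn
  -- the radius `1 / √(n l)` is the one that gives the best bound
  obtain ⟨r, hr⟩ : ∃ r, r = 1 / √(n * l) := ⟨_, rfl⟩
  have hr0 : 0 < r := by rw [hr]; positivity
  have hr2 : n * r ^ 2 * l = 1 := by
    rw [hr, div_pow, Real.sq_sqrt (by positivity)]; field_simp
  have hrr : r < r₀ := by
    rw [div_lt_iff₀ (by positivity)] at hn
    have h1 : n * r ^ 2 * c ≤ 1 := by rw [← hr2]; gcongr
    have h2 : (n * c) * r ^ 2 < (n * c) * r₀ ^ 2 := by linarith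
    exact lt_of_pow_lt_pow_left₀ 2 hr₀.le (lt_of_mul_lt_mul_left h2 (by positivity))
  obtain ⟨hball, hi, hmean⟩ := hexp _ hj r hr0 hrr
  have hJ := (hF n).log_le_circleMean hQ hjk hr0 hball hi
  have h1 := (abs_le.1 hmean).2
  change _ - _ - r ^ 2 * l ≤ _ at h1
  have h2 : 2 * (Real.log r - Real.log ‖F n j - F n k‖) ≤ 1 + 2 * δ := by
    refine hJ.trans ?_
    calc n * (∫ z, (Q z).toReal ∂circleMeasure (F n j) r - (Q (F n j)).toReal)
        ≤ n * (r ^ 2 * l + 2 * δ * c * r ^ 2) := by gcongr; linarith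
      _ ≤ n * (r ^ 2 * l + 2 * δ * l * r ^ 2) := by gcongr
      _ = n * r ^ 2 * l * (1 + 2 * δ) := by ring
      _ = 1 + 2 * δ := by rw [hr2, one_mul]
  have hd0 : 0 < ‖F n j - F n k‖ := by
    obtain ⟨hinj, -⟩ := (hF n).properties hQ (hne.mono hKi)
    exact norm_pos_iff.2 (sub_ne_zero.2 fun h => hjk (hinj h).symm)
  have h3 : Real.log r - (1 / 2 + δ) ≤ Real.log ‖F n j - F n k‖ := by linarith
  have h4 := Real.exp_le_exp.2 h3
  rw [Real.exp_log hd0, Real.exp_sub, Real.exp_log hr0, Real.exp_add] at h4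
  rw [dist_comm, dist_eq_norm]
  refine le_trans ?_ h4
  have h5 : √(Real.exp 1 * n * l) = Real.exp (1 / 2) * √(n * l) := by
    rw [mul_assoc, Real.sqrt_mul (Real.exp_pos _).le, ← Real.exp_half]
  have h6 : r / (Real.exp (1 / 2) * Real.exp δ) =
      Real.exp (-δ) / (Real.exp (1 / 2) * √(n * l)) := by
    rw [hr, Real.exp_neg]; field_simp
  rw [h5, h6]
  gcongr
  have := Real.add_one_le_exp (-δ)
  linarith

/-- If a monotone condition `P n δ` holds for all large `n` whenever `δ > 0`, then it holds for
all large `n` along some sequence of parameters tending to zero. -/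
theorem exists_tendsto_zero {P : ℕ → ℝ → Prop} (hmono : ∀ n δ δ', δ ≤ δ' → P n δ → P n δ')
    (hP : ∀ δ > 0, ∀ᶠ n in atTop, P n δ) :
    ∃ ε : ℕ → ℝ, Tendsto ε atTop (𝓝 0) ∧ ∀ᶠ n in atTop, P n (ε n) := by
  have hbdd : ∀ n, BddBelow {δ : ℝ | 0 < δ ∧ P n δ} := fun n => ⟨0, fun _ h => h.1.le⟩
  have hinf0 : ∀ n, 0 ≤ sInf {δ : ℝ | 0 < δ ∧ P n δ} := fun n =>
    Real.sInf_nonneg fun _ h => h.1.le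
  have hlim : Tendsto (fun n => sInf {δ : ℝ | 0 < δ ∧ P n δ}) atTop (𝓝 0) := by
    refine Metric.tendsto_nhds.2 fun η hη => ?_
    filter_upwards [hP (η / 2) (by positivity)] with n hn
    have := csInf_le (hbdd n) (show η / 2 ∈ {δ : ℝ | 0 < δ ∧ P n δ} from ⟨by positivity, hn⟩)
    rw [Real.dist_eq, sub_zero, abs_of_nonneg (hinf0 n)]
    linarith
  refine ⟨fun n => sInf {δ : ℝ | 0 < δ ∧ P n δ} + 1 / ((n : ℝ) + 1), ?_, ?_⟩
  · simpa using hlim.add tendsto_one_div_add_atTop_nhds_zero_nat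
  · filter_upwards [hP 1 one_pos] with n hn
    obtain ⟨δ, hδ, hlt⟩ := exists_lt_of_csInf_lt
      (⟨1, one_pos, hn⟩ : {δ : ℝ | 0 < δ ∧ P n δ}.Nonempty)
      (lt_add_of_pos_right _ (by positivity : 0 < 1 / ((n : ℝ) + 1)))
    exact hmono n δ _ hlt.le hδ.2

end Fekete

theorem theorem1
    (Q : ℂ → EReal) (hQ : Fekete.IsExternalPotential Q)
    -- the equilibrium measure, whose support is the droplet
    (σ : Measure ℂ) (hσ : Fekete.IsEquilibriumMeasure Q σ)
    (hS : σ.support ⊆ interior (Fekete.finiteSet Q))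
    -- strict subharmonicity in a neighbourhood of the droplet
    (hsub : ∃ U : Set ℂ, IsOpen U ∧ σ.support ⊆ U ∧ U ⊆ interior (Fekete.finiteSet Q) ∧
      ∀ z ∈ U, 0 < Fekete.lap Q z)
    (F : (n : ℕ) → Fin n → ℂ) (hF : ∀ n, Fekete.IsFeketeSet Q (F n)) :
    -- the bound for the asymptotic separation constant
    ENNReal.ofReal (1 / √(Real.exp 1)) ≤ Fekete.separationConstant Q F ∧
    -- the same bound in terms of distances between points
    (∃ ε : ℕ → ℝ, Tendsto ε atTop (𝓝 0) ∧
      ∀ᶠ n : ℕ in atTop, ∀ j : Fin n, F n j ∈ interior (Fekete.finiteSet Q) →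
        0 < Fekete.lap Q (F n j) ∧
        ∀ k : Fin n, k ≠ j →
          (1 + ε n) / √(Real.exp 1 * (n : ℝ) * Fekete.lap Q (F n j)) ≤ dist (F n k) (F n j)) ∧
    -- unless the potential jumps down at the boundary, no Fekete point is left out above
    (Fekete.NoDownwardJump Q →
      ∀ᶠ n : ℕ in atTop, ∀ j : Fin n, F n j ∈ σ.support) := by
  obtain ⟨γ, hγ⟩ := hσ.exists_isFrostman hQ hS
  obtain ⟨U, hUo, hSU, hUi, hlap⟩ := hsub
  have hloc := hγ.eventually_mem_support hQ hUo hSU hUi hlap hF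
  have hP : ∀ δ > 0, ∀ᶠ n : ℕ in atTop, ∀ j : Fin n, F n j ∈ interior (Fekete.finiteSet Q) →
      0 < Fekete.lap Q (F n j) ∧ ∀ k : Fin n, k ≠ j →
        (1 - δ) / √(Real.exp 1 * (n : ℝ) * Fekete.lap Q (F n j)) ≤ dist (F n k) (F n j) := by
    intro δ hδ
    filter_upwards [hloc, Fekete.eventually_separated hQ hγ.compact hS
      (fun z hz => hlap z (hSU hz)) hF hδ] with n h1 h2 j hj
    have hjS := h1 j (hγ.le _ hj)
    exact ⟨hlap _ (hSU hjS), h2 j hjS⟩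
  obtain ⟨ε, hε, hPε⟩ := Fekete.exists_tendsto_zero
    (fun n δ δ' hδ h j hj => ⟨(h j hj).1, fun k hk => le_trans (by gcongr) ((h j hj).2 k hk)⟩) hP
  have hε' : Tendsto (fun n => 1 + -ε n) atTop (𝓝 1) := by simpa using hε.neg.const_add 1
  refine ⟨?_, ⟨fun n => -ε n, by simpa using hε.neg, ?_⟩, fun hjump => ?_⟩
  · have hlim : Tendsto (fun n => ENNReal.ofReal ((1 + -ε n) / √(Real.exp 1))) atTop
        (𝓝 (ENNReal.ofReal (1 / √(Real.exp 1)))) :=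
      ENNReal.tendsto_ofReal (hε'.div_const _)
    rw [← hlim.liminf_eq]
    refine liminf_le_liminf ?_
    filter_upwards [hPε] with n hn
    refine le_iInf₂ fun j hj => ?_
    obtain ⟨hl, hd⟩ := hn j hj
    have hn0 : (0 : ℝ) < n := by exact_mod_cast j.pos
    have hs0 : 0 < √((n : ℝ) * Fekete.lap Q (F n j)) := by positivity
    rw [mul_comm, ← ENNReal.div_le_iff (ENNReal.ofReal_pos.2 hs0).ne' ENNReal.ofReal_ne_top,
      ← ENNReal.ofReal_div_of_pos hs0]
    refine le_iInf₂ fun k hk => ?_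
    rw [edist_dist]
    refine ENNReal.ofReal_le_ofReal (le_trans (le_of_eq ?_) (hd k hk))
    rw [mul_assoc, Real.sqrt_mul (Real.exp_pos 1).le, div_div, sub_eq_add_neg]
  · filter_upwards [hPε] with n hn j hj
    exact ⟨(hn j hj).1, fun k hk => by simpa [sub_eq_add_neg] using (hn j hj).2 k hk⟩
  · filter_upwards [hloc] with n hn j
    refine hn j (hγ.le_of_noDownwardJump hQ hjump ?_)
    exact ((hF n).properties hQ (hγ.nonempty.mono hS)).2.1 j
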